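/- For a probability distribution \(P=(p_i)_{i=1}^{d}\) let \(|\psi_P\rangle=\sum_{i=1}^{d}\sqrt{p_i}\,|ii\rangle\in\mathbb C^{d}\otimes\mathbb C^{d}\), and for \(\alpha\in[0,1]\) let \(H_\alpha(P)=\frac1{1-\alpha}\log_2\sum_{i:\,p_i>0}p_i^{\alpha}\) for \(\alpha\neq1\) and \(H_1(P)=-\sum_i p_i\log_2 p_i\) be the Rényi entropies. A one-step LOCC channel acts on bipartite operators with a finite classical register: one of the two parties applies finitely many Kraus operators \(K_j\), where \(j\) is applied when the register has the value \(f(j)\) and the register is then set to \(g(j)\), subject to \(\sum_{j:\,f(j)=x}K_j^*K_j\le I\) for every register value \(x\). An LOCC channel is a finite composition of one-step LOCC channels. For bipartite vectors write \(|\psi\rangle\xrightarrow{\mathrm{LOCC}}|\phi\rangle\) if some LOCC channel maps \(|\psi\rangle\langle\psi|\) to \(|\phi\rangle\langle\phi|\) (with one-point initial and final registers); thus, for unit vectors, \(|\psi\rangle\xrightarrow{\mathrm{LOCC}}\sqrt p\,|\phi\rangle\) means that \(|\phi\rangle\) is extracted exactly from \(|\psi\rangle\) with success probability \(p\). Let \(E(\psi,\phi)\)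 be the supremum of all real \(\tau\ge0\) for which there is a sequence \(p_n\to1\) with \(p_n\ge0\) and \(|\psi\rangle^{\otimes n}\xrightarrow{\mathrm{LOCC}}\sqrt{p_n}\,|\phi\rangle^{\otimes\lfloor\tau n\rfloor}\) for all sufficiently large \(n\). Theorem. Let \(P=(p_i)_{i=1}^{d_1}\) and \(Q=(q_j)_{j=1}^{d_2}\) be probability distributions, with \(Q\) not concentrated on a single point (equivalently, \(H_\alpha(Q)>0\) for all \(\alpha\in[0,1]\)). Then the minimum of \(H_\alpha(P)/H_\alpha(Q)\) over \(\alpha\in[0,1]\) exists, and \[ E(\psi_P,\psi_Q)=\min_{\alpha\in[0,1]}\frac{H_\alpha(P)}{H_\alpha(Q)} . \] -/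

import Mathlib

namespace BipartiteLOCC

open Filter Topology
open scoped Kronecker ComplexOrder

noncomputable section

/-- The space `B(ℂ^a) ⊗ B(ℂ^b) ⊗ Diag(ℂ^X)` of bipartite operators with a classical register `X`,
written as a family of operators on `ℂ^a ⊗ ℂ^b` indexed by the register:
`ρ` stands for `∑ x, ρ x ⊗ |x⟩⟨x|`. States are its positive elements. -/
abbrev RegOp (a b X : Type) : Type := X → Matrix (a × b) (a × b) ℂ

open Classical in
/-- The Kraus constraint `∑ j, K_j^* K_j ⊗ |f j⟩⟨f j| ≤ I`, block by block in the register. -/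
def KrausConstraint {a a' X J : Type} [Fintype a] [Fintype a'] [Fintype J]
    (f : J → X) (K : J → Matrix a' a ℂ) : Prop :=
  ∀ x : X, (1 - ∑ j with f j = x, (K j).conjTranspose * K j).PosSemidef

open Classical in
/-- The map `ρ ↦ ∑ j, (L_j ⊗ |g j⟩⟨f j|) ρ (L_j^* ⊗ |f j⟩⟨g j|)`. -/
def krausMap {a b a' b' X Y J : Type} [Fintype a] [Fintype b] [Fintype J]
    (f : J → X) (g : J → Y) (L : J → Matrix (a' × b') (a × b) ℂ) :
    RegOp a b X → RegOp a' b' Y :=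
  fun ρ y => ∑ j with g j = y, L j * ρ (f j) * (L j).conjTranspose

open Classical in
/-- LOCC channels between bipartite state spaces: finite compositions of one-step LOCC channels.
In a one-step channel one of the two parties applies Kraus operators chosen according to the
register (read by `f`), and the outcome is written into the new register (by `g`). -/
inductive IsLOCCChannel :
    ∀ {a b X a' b' Y : Type} [Fintype a] [Fintype b] [Fintype X]
      [Fintype a'] [Fintype b'] [Fintype Y], (RegOp a b X → RegOp a' b' Y) → Prop
  | first {a b X a' Y J : Type} [Fintype a] [Fintype b] [Fintype X] [Fintype a'] [Fintype Y]
      [Fintype J] (f : J → X) (g : J → Y) (K : J → Matrix a' a ℂ) (hK : KrausConstraint f K) :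
      IsLOCCChannel (krausMap f g fun j => K j ⊗ₖ (1 : Matrix b b ℂ))
  | second {a b X b' Y J : Type} [Fintype a] [Fintype b] [Fintype X] [Fintype b'] [Fintype Y]
      [Fintype J] (f : J → X) (g : J → Y) (K : J → Matrix b' b ℂ) (hK : KrausConstraint f K) :
      IsLOCCChannel (krausMap f g fun j => (1 : Matrix a a ℂ) ⊗ₖ K j)
  | comp {a b X a' b' Y a'' b'' Z : Type} [Fintype a] [Fintype b] [Fintype X]
      [Fintype a'] [Fintype b'] [Fintype Y] [Fintype a''] [Fintype b''] [Fintype Z]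
      {Λ₁ : RegOp a b X → RegOp a' b' Y} {Λ₂ : RegOp a' b' Y → RegOp a'' b'' Z}
      (h₁ : IsLOCCChannel Λ₁) (h₂ : IsLOCCChannel Λ₂) : IsLOCCChannel (Λ₂ ∘ Λ₁)

/-- The (unnormalized) pure state `|ψ⟩⟨ψ|` with a one-point register. -/
def pureState {a b : Type} (ψ : a × b → ℂ) : RegOp a b Unit :=
  fun _ => Matrix.vecMulVec ψ (star ψ)

/-- `|ψ⟩ → |φ⟩` by LOCC, for unnormalized vectors. -/
def LOCCConvertible {a b a' b' : Type} [Fintype a] [Fintype b] [Fintype a'] [Fintype b']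
    (ψ : a × b → ℂ) (φ : a' × b' → ℂ) : Prop :=
  ∃ Λ : RegOp a b Unit → RegOp a' b' Unit, IsLOCCChannel Λ ∧ Λ (pureState ψ) = pureState φ

/-- For normalized `ψ` and `φ`: the state `φ` is extracted exactly from `ψ`, with success
probability `p`. -/
def ExtractsWithProb {a b a' b' : Type} [Fintype a] [Fintype b] [Fintype a'] [Fintype b']
    (ψ : a × b → ℂ) (φ : a' × b' → ℂ) (p : ℝ) : Prop :=
  0 ≤ p ∧ LOCCConvertible ψ (((√p : ℝ) : ℂ) • φ)

/-- The `n`-fold tensor power of a bipartite vector, as a bipartite vector. -/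
def tensorPow {a b : Type} (ψ : a × b → ℂ) (n : ℕ) : (Fin n → a) × (Fin n → b) → ℂ :=
  fun s => ∏ i, ψ (s.1 i, s.2 i)

/-- `τ` is an achievable rate: for all large `n`, `⌊τ n⌋` copies of `φ` can be extracted from `n`
copies of `ψ`, with success probability tending to `1`. -/
def IsAchievableRate {a b a' b' : Type} [Fintype a] [Fintype b] [Fintype a'] [Fintype b']
    (ψ : a × b → ℂ) (φ : a' × b' → ℂ) (τ : ℝ) : Prop :=
  0 ≤ τ ∧ ∃ p : ℕ → ℝ, Tendsto p atTop (𝓝 1) ∧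
    ∀ᶠ n : ℕ in atTop, ExtractsWithProb (tensorPow ψ n) (tensorPow φ ⌊τ * n⌋₊) (p n)

/-- The optimal extraction rate `E(ψ, φ)`, an extended real number. -/
def extractionRate {a b a' b' : Type} [Fintype a] [Fintype b] [Fintype a'] [Fintype b']
    (ψ : a × b → ℂ) (φ : a' × b' → ℂ) : EReal :=
  sSup {t : EReal | ∃ τ : ℝ, IsAchievableRate ψ φ τ ∧ t = (τ : EReal)}

/-- The bipartite pure state `∑ i, √(p i) |i i⟩`. -/
def schmidtState {d : ℕ} (P : Fin d → ℝ) : Fin d × Fin d → ℂ :=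
  fun s => if s.1 = s.2 then ((√(P s.1) : ℝ) : ℂ) else 0

/-- The Rényi entropy of order `α`; at `α = 1` it is the Shannon entropy. The sum runs over the
support of `P`, so that order `0` gives the logarithm of the size of the support. -/
def renyiEntropy {d : ℕ} (α : ℝ) (P : Fin d → ℝ) : ℝ :=
  if α = 1 then -∑ i, P i * Real.logb 2 (P i)
  else 1 / (1 - α) * Real.logb 2 (∑ i with P i ≠ 0, P i ^ α)

end

end BipartiteLOCC

namespace BipartiteLOCC

open Filter Topology MeasureTheory
open scoped Kronecker ComplexOrder

/-! LOCC conversion between Schmidt vectors is decided by the threshold sums `truncSum p t = ∑ min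
(p i) t`: the vector of `p` can be converted to that of `q`, not necessarily normalized, exactly
when `truncSum q t ≤ truncSum p t` for all `t ≥ 0`. Sufficiency (`loccConvertible_schmidtVec`): the
domination is weak majorization, so `p` lies above an average of rearrangements of `q`
(Hahn–Banach). The weights of this average define a measurement by one party, after which the other
party relabels its basis. Necessity (`LOCCConvertible.truncSum_le`): local operations raise neither
Schmidt rank nor total squared distance to vectors of rank at most `k`. For a Schmidt vector this
distance plus `k * t` is at least the threshold sum, with equality for a suitable `k`.

The question becomes one about threshold sums of product distributions. Integrating `truncSum p t`
against `t ^ (α - 2)` gives a positive multiple of `∑ p i ^ α`, so domination implies domination of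
power sums for `0 < α < 1`. Power sums are multiplicative, which gives `τ * H_α(Q) ≤ H_α(P)`; the
endpoints follow by continuity.

Conversely, write `Z_α` for `powSum α` and `s α` for `tiltedMean α P`. At `t = exp (-n * s α)` the
threshold sum of `P^n` has exponent at least about `log Z_α(P) - (1 - α) * s α`, by concentration
under the law proportional to `P ^ α`. The elementary bound `min x t ≤ x ^ α * t ^ (1 - α)` gives at
most `τ * log Z_α(Q) - (1 - α) * s α` for `Q`. The difference is `(1 - α) * (H_α(P) - τ * H_α(Q)) *
log 2`, positive if all entropy inequalities are strict and `α < 1`. It degenerates at `α = 1`, so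
thresholds near that end are treated separately; this is where the success probability drops below
one. -/

/-- The concave threshold sum `∑ i, min (p i) t`. Its values for all `t ≥ 0` encode the sums of the
smallest entries of `p`. -/
noncomputable def truncSum {ι : Type*} [Fintype ι] (p : ι → ℝ) (t : ℝ) : ℝ := ∑ i, min (p i) t

/-! ### Weak majorization and averages of rearrangements -/

theorem exists_perm_antivary {ι : Type*} [Fintype ι] (c q : ι → ℝ) :
    ∃ σ : Equiv.Perm ι, Antivary c (q ∘ σ) := by
  classical
  let e := Fintype.equivFin ι
  let s := Tuple.sort (c ∘ e.symm)
  let r := Tuple.sort (fun i => -q (e.symm i))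
  have hs : Monotone ((c ∘ e.symm) ∘ s) := Tuple.monotone_sort _
  have hr : Monotone ((fun i => -q (e.symm i)) ∘ r) := Tuple.monotone_sort _
  refine ⟨(e.trans s.symm).trans (r.trans e.symm), ?_⟩
  intro i j hij
  by_contra! hc
  have hc' : s.symm (e i) < s.symm (e j) := by
    by_contra! h
    have := hs h
    simp at this
    linarith
  have := hr hc'.le
  simp at this hij
  linarith

/-- Truncate at the largest value of `q` on the superlevel set of `c`. On that set `q` is unchanged,
and off it `q` is at least this value by antivariance, so the threshold inequality reduces to the
claim. -/
theorem sum_superlevel_le {ι : Type*} [Fintype ι] {c p q : ι → ℝ} (hanti : Antivary c q)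
    (hq : ∀ i, 0 ≤ q i) (h : ∀ t, 0 ≤ t → truncSum q t ≤ truncSum p t) (u : ℝ) :
    ∑ i with u < c i, q i ≤ ∑ i with u < c i, p i := by
  classical
  rcases (Finset.univ.filter fun i => u < c i).eq_empty_or_nonempty with he | hne
  · simp [he]
  obtain ⟨k, hk, hmax⟩ := Finset.exists_max_image _ q hne
  have hk' : u < c k := by simpa using hk
  have h1 := h (q k) (hq k)
  unfold truncSum at h1
  rw [← Finset.sum_filter_add_sum_filter_not Finset.univ (fun i => u < c i),
    ← Finset.sum_filter_add_sum_filter_not Finset.univ (fun i => u < c i)] at h1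
  have e1 : ∑ i with u < c i, min (q i) (q k) = ∑ i with u < c i, q i :=
    Finset.sum_congr rfl fun i hi => min_eq_left (hmax i hi)
  have e2 : ∑ i with ¬ u < c i, min (q i) (q k) = ∑ i with ¬ u < c i, q k := by
    refine Finset.sum_congr rfl fun i hi => min_eq_right ?_
    by_contra! hc
    have := hanti hc
    simp at hi
    linarith
  have e3 : ∑ i with u < c i, min (p i) (q k) ≤ ∑ i with u < c i, p i :=
    Finset.sum_le_sum fun i _ => min_le_left _ _
  have e4 : ∑ i with ¬ u < c i, min (p i) (q k) ≤ ∑ i with ¬ u < c i, q k :=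
    Finset.sum_le_sum fun i _ => min_le_right _ _
  linarith

theorem eq_integral_indicator_lt {c M : ℝ} (hc : 0 ≤ c) (hM : c ≤ M) :
    ∫ u in Set.Ioc 0 M, (if u < c then (1 : ℝ) else 0) = c := by
  have : (fun u : ℝ => if u < c then (1 : ℝ) else 0) = (Set.Iio c).indicator fun _ => 1 := by
    ext u; simp [Set.indicator]
  rw [this, setIntegral_indicator measurableSet_Iio]
  have : Set.Ioc 0 M ∩ Set.Iio c = Set.Ioo 0 c := by
    ext u; constructor
    · rintro ⟨⟨a, b⟩, d⟩; exact ⟨a, d⟩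
    · rintro ⟨a, b⟩; exact ⟨⟨a, b.le.trans hM⟩, b⟩
  rw [this]
  simp [hc]

/-- Layer cake: `c` is the integral of the indicators of its superlevel sets, and each level is
handled by `sum_superlevel_le`. -/
theorem sum_mul_le_of_antivary {ι : Type*} [Fintype ι] {c p q : ι → ℝ} (hanti : Antivary c q)
    (hc : ∀ i, 0 ≤ c i) (hq : ∀ i, 0 ≤ q i)
    (h : ∀ t, 0 ≤ t → truncSum q t ≤ truncSum p t) :
    ∑ i, c i * q i ≤ ∑ i, c i * p i := by
  classical
  set M := ∑ i, c i with hMdef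
  have hM : ∀ i, c i ≤ M := fun i => Finset.single_le_sum (fun j _ => hc j) (Finset.mem_univ i)
  have hint : ∀ (i : ι) (v : ℝ), Integrable (fun u => (if u < c i then (1 : ℝ) else 0) * v)
      (volume.restrict (Set.Ioc 0 M)) := by
    intro i v
    refine Integrable.mul_const ?_ v
    have : (fun u : ℝ => if u < c i then (1 : ℝ) else 0) = (Set.Iio (c i)).indicator fun _ => 1 := by
      ext u; simp [Set.indicator]
    rw [this]
    exact (integrable_const _).indicator measurableSet_Iio
  have key : ∀ r : ι → ℝ, ∑ i, c i * r i =
      ∫ u in Set.Ioc 0 M, ∑ i, (if u < c i then (1 : ℝ) else 0) * r i := by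
    intro r
    rw [integral_finsetSum _ fun i _ => hint i (r i)]
    refine Finset.sum_congr rfl fun i _ => ?_
    rw [integral_mul_const, eq_integral_indicator_lt (hc i) (hM i)]
  rw [key, key]
  refine integral_mono (integrable_finsetSum _ fun i _ => hint i _)
    (integrable_finsetSum _ fun i _ => hint i _) fun u => ?_
  have := sum_superlevel_le hanti hq h u
  simpa [Finset.sum_filter] using this

/-- Weak majorization: if the threshold sums of `q` are below those of `p`, then `p` dominates a
convex combination of rearrangements of `q`. -/
theorem exists_convex_rearrangement_le {ι : Type*} [Fintype ι] [DecidableEq ι] {p q : ι → ℝ}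
    (hq : ∀ i, 0 ≤ q i) (h : ∀ t, 0 ≤ t → truncSum q t ≤ truncSum p t) :
    ∃ w ∈ stdSimplex ℝ (Equiv.Perm ι), ∀ i, ∑ σ, w σ * q (σ i) ≤ p i := by
  let L : (Equiv.Perm ι → ℝ) →ₗ[ℝ] (ι → ℝ) :=
    { toFun := fun w i => ∑ σ, w σ * q (σ i)
      map_add' := fun v w => by ext i; simp [add_mul, Finset.sum_add_distrib]
      map_smul' := fun r w => by ext i; simp [Finset.mul_sum, mul_assoc] }
  by_contra hex
  replace hex : ∀ w ∈ stdSimplex ℝ (Equiv.Perm ι), ¬ L w ≤ p :=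
    fun w hw hle => hex ⟨w, hw, hle⟩
  have hL : Continuous L := L.continuous_of_finiteDimensional
  -- Separate the down-set of `p` from the polytope spanned by the rearrangements of `q`.
  obtain ⟨f, u, v, hf1, huv, hf2⟩ := geometric_hahn_banach_closed_compact (convex_Iic p)
    (isClosed_Iic (a := p)) ((convex_stdSimplex ℝ (Equiv.Perm ι)).linear_image L)
    ((isCompact_stdSimplex ℝ (Equiv.Perm ι)).image hL) (by
      rw [Set.disjoint_left]
      rintro a ha ⟨w, hw, rfl⟩
      exact hex w hw ha)
  let c : ι → ℝ := fun i => f (Pi.single i 1)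
  have hfc : ∀ a : ι → ℝ, f a = ∑ i, c i * a i := by
    intro a
    conv_lhs => rw [pi_eq_sum_univ' a]
    simp only [map_sum, map_smul, smul_eq_mul, c]
    refine Finset.sum_congr rfl fun i _ => ?_
    rw [mul_comm]
  have hc : ∀ i, 0 ≤ c i := by
    intro i
    by_contra! hneg
    -- Lowering the `i`-th coordinate of `p` by `r` stays in the down-set but would raise `f` to
    -- exactly `u`.
    set r := (u - f p) / (-c i) with hr
    have hfp := hf1 p (Set.mem_Iic.2 le_rfl)
    have hr0 : 0 < r := div_pos (by linarith) (by linarith)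
    have := hf1 (p - r • Pi.single i 1) (by
      rw [Set.mem_Iic, sub_le_self_iff]
      exact smul_nonneg hr0.le (by rw [Pi.single_nonneg]; exact zero_le_one))
    rw [map_sub, map_smul, smul_eq_mul] at this
    have h2 : r * c i = -(u - f p) := by
      rw [hr, div_neg, neg_mul, div_mul_cancel₀ _ hneg.ne]
    change f p - r * c i < u at this
    linarith
  -- The oppositely ordered rearrangement makes the functional small enough to contradict
  -- separation.
  obtain ⟨σ, hσ⟩ := exists_perm_antivary c q
  have h3 := sum_mul_le_of_antivary (p := p) hσ hc (fun i => hq _) (fun t ht => by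
    refine le_trans (le_of_eq ?_) (h t ht)
    exact Equiv.sum_comp σ fun i => min (q i) t)
  have h4 := hf2 (L (Pi.single σ 1)) ⟨_, single_mem_stdSimplex ℝ σ, rfl⟩
  have h5 : L (Pi.single σ 1) = q ∘ σ := by
    ext i
    simp [L, Pi.single_apply]
  rw [h5, hfc] at h4
  have h6 := hf1 p (Set.mem_Iic.2 le_rfl)
  rw [hfc] at h6
  linarith

/-! ### Sufficiency: the one-way LOCC protocol -/

open Classical in
/-- The vector `∑ i, √(p i) |i i⟩` over an arbitrary index type. -/
noncomputable def schmidtVec {ι : Type} (p : ι → ℝ) : ι × ι → ℂ :=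
  fun s => if s.1 = s.2 then ((√(p s.1) : ℝ) : ℂ) else 0

/-- The rank one operator `|v⟩⟨v|`. -/
def dyad {n : Type} (v : n → ℂ) : Matrix n n ℂ := Matrix.vecMulVec v (star v)

theorem mul_dyad_mul_conjTranspose {m n : Type} [Fintype n] (L : Matrix m n ℂ) (v : n → ℂ) :
    L * dyad v * L.conjTranspose = dyad (L.mulVec v) := by
  rw [dyad, dyad, Matrix.mul_vecMulVec, Matrix.vecMulVec_mul, Matrix.star_mulVec]

theorem dyad_smul {n : Type} (c : ℂ) (v : n → ℂ) :
    dyad (c • v) = (c * star c) • dyad v := by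
  ext i j
  simp [dyad, Matrix.vecMulVec_apply]
  ring

theorem sum_dyad_sqrt_smul {n S : Type} [Fintype S] {w : S → ℝ} (hw : w ∈ stdSimplex ℝ S)
    (v : n → ℂ) : ∑ s, dyad (((√(w s) : ℝ) : ℂ) • v) = dyad v := by
  have h1 : ∀ s, dyad (((√(w s) : ℝ) : ℂ) • v) = ((w s : ℝ) : ℂ) • dyad v := by
    intro s
    rw [dyad_smul]
    congr 1
    simp only [Complex.star_def, Complex.conj_ofReal]
    rw [← Complex.ofReal_mul, Real.mul_self_sqrt (hw.1 s)]
  simp_rw [h1, ← Finset.sum_smul, ← Complex.ofReal_sum, hw.2]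
  simp

open Classical in
theorem kronecker_one_mulVec {a a' b : Type} [Fintype a] [Fintype b] (K : Matrix a' a ℂ)
    (v : a × b → ℂ) (i : a') (j : b) :
    ((K ⊗ₖ (1 : Matrix b b ℂ)).mulVec v) (i, j) = ∑ k, K i k * v (k, j) := by
  simp [Matrix.mulVec, dotProduct, Fintype.sum_prod_type, Matrix.kroneckerMap_apply,
    Matrix.one_apply]

open Classical in
theorem one_kronecker_mulVec {a b b' : Type} [Fintype a] [Fintype b] (K : Matrix b' b ℂ)
    (v : a × b → ℂ) (i : a) (j : b') :
    (((1 : Matrix a a ℂ) ⊗ₖ K).mulVec v) (i, j) = ∑ k, K j k * v (i, k) := by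
  simp [Matrix.mulVec, dotProduct, Fintype.sum_prod_type, Matrix.kroneckerMap_apply,
    Matrix.one_apply]

-- An index sent to the left summand is discarded. The matrix has at most one nonzero entry per row
-- and column, so its columns are orthogonal.
open Classical in
theorem conjTranspose_mul_self_of_partial_injection {ι κ : Type} [Fintype ι] [Fintype κ]
    (e : ι → ι ⊕ κ) (he : Function.Injective e) (c : ι → κ → ℝ) :
    (Matrix.of fun (j : κ) (i : ι) => if e i = Sum.inr j then ((c i j : ℝ) : ℂ) else 0).conjTranspose
      * (Matrix.of fun (j : κ) (i : ι) => if e i = Sum.inr j then ((c i j : ℝ) : ℂ) else 0) =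
    Matrix.diagonal fun i => ((Sum.elim (fun _ => 0) (fun j => c i j ^ 2) (e i) : ℝ) : ℂ) := by
  ext i i'
  rw [Matrix.mul_apply]
  simp only [Matrix.conjTranspose_apply, Matrix.of_apply]
  by_cases h : i = i'
  · subst h
    rw [Matrix.diagonal_apply_eq]
    rcases hi : e i with k | k
    · simp
    · simp only [Sum.inr.injEq, Sum.elim_inr]
      rw [Finset.sum_eq_single k]
      · simp [sq]
      · intro b _ hb; simp [hb.symm]
      · simp
  · rw [Matrix.diagonal_apply_ne _ h]
    refine Finset.sum_eq_zero fun j _ => ?_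
    by_cases h1 : e i = Sum.inr j
    · have : e i' ≠ Sum.inr j := fun h2 => h (he (h1.trans h2.symm))
      simp [this]
    · simp [h1]

open Classical in
/-- Nielsen's theorem with success probability: domination of the threshold sums suffices. -/
theorem loccConvertible_schmidtVec {ι κ : Type} [Fintype ι] [Fintype κ] {p : ι → ℝ} {q : κ → ℝ}
    (hp : ∀ i, 0 ≤ p i) (hq : ∀ j, 0 ≤ q j)
    (h : ∀ t, 0 ≤ t → truncSum q t ≤ truncSum p t) :
    LOCCConvertible (schmidtVec p) (schmidtVec q) := by
  -- Padding both vectors by zeros on the disjoint union gives a common index set, on which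
  -- permutations induce partial injections from `ι` to `κ`.
  obtain ⟨w, hw, hle⟩ := exists_convex_rearrangement_le (ι := ι ⊕ κ)
    (p := Sum.elim p fun _ => 0) (q := Sum.elim (fun _ => 0) q)
    (by rintro (i | j) <;> simp [hq]) (by
      intro t ht
      simpa [truncSum, ht] using h t ht)
  have hq' : ∀ x, 0 ≤ Sum.elim (fun _ : ι => (0 : ℝ)) q x := by rintro (i | j) <;> simp [hq]
  have hle1 : ∀ σ x, w σ * Sum.elim (fun _ => (0 : ℝ)) q (σ x) ≤ Sum.elim p (fun _ => 0) x :=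
    fun σ x => (Finset.single_le_sum
      (f := fun τ : Equiv.Perm (ι ⊕ κ) => w τ * Sum.elim (fun _ => (0 : ℝ)) q (τ x))
      (fun τ _ => mul_nonneg (hw.1 τ) (hq' _))
      (Finset.mem_univ σ)).trans (hle x)
  -- The first party measures `σ` with `K σ`, which reweights `p` to `w σ * q` and relabels its own
  -- index; the second party reads `σ` and relabels to match with `L σ`.
  let K : Equiv.Perm (ι ⊕ κ) → Matrix κ ι ℂ := fun σ =>
    Matrix.of fun j i => if σ (Sum.inl i) = Sum.inr j then ((√(w σ * q j / p i) : ℝ) : ℂ) else 0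
  let L : Equiv.Perm (ι ⊕ κ) → Matrix κ ι ℂ := fun σ =>
    Matrix.of fun j i => if σ (Sum.inl i) = Sum.inr j then ((1 : ℝ) : ℂ) else 0
  have hinj : ∀ σ : Equiv.Perm (ι ⊕ κ), Function.Injective fun i => σ (Sum.inl i) :=
    fun σ => σ.injective.comp Sum.inl_injective
  have hK : KrausConstraint (fun _ : Equiv.Perm (ι ⊕ κ) => ()) K := by
    intro x
    have hpos : (Matrix.diagonal fun i =>
        (((1 - ∑ σ, w σ * Sum.elim (fun _ => (0 : ℝ)) q (σ (Sum.inl i)) / p i : ℝ)) :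
        ℂ)).PosSemidef := by
      rw [Matrix.posSemidef_diagonal_iff]
      intro i
      rw [← Complex.ofReal_zero, Complex.real_le_real, sub_nonneg, ← Finset.sum_div]
      exact div_le_one_of_le₀ (hle (Sum.inl i)) (hp i)
    convert hpos using 1
    have h1 : ∀ σ, (K σ).conjTranspose * K σ = Matrix.diagonal fun i =>
        ((w σ * Sum.elim (fun _ => (0 : ℝ)) q (σ (Sum.inl i)) / p i : ℝ) : ℂ) := by
      intro σ
      have := conjTranspose_mul_self_of_partial_injection _ (hinj σ)
        (fun i j => √(w σ * q j / p i))
      refine this.trans ?_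
      congr 1
      ext i
      congr 1
      rcases σ (Sum.inl i) with k | k
      · simp
      · simp only [Sum.elim_inr]
        rw [Real.sq_sqrt (div_nonneg (mul_nonneg (hw.1 _) (hq _)) (hp _))]
    simp_rw [h1]
    ext i i'
    by_cases hii : i = i'
    · subst hii; simp [Matrix.sum_apply]
    · simp [Matrix.sum_apply, hii]
  have hL : KrausConstraint (id : Equiv.Perm (ι ⊕ κ) → _) L := by
    intro σ
    have hpos : (Matrix.diagonal fun i : ι => ((1 - Sum.elim (fun _ => 0) (fun _ => (1 : ℝ) ^ 2)
        (σ (Sum.inl i)) : ℝ) : ℂ)).PosSemidef := by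
      rw [Matrix.posSemidef_diagonal_iff]
      intro i
      rw [← Complex.ofReal_zero, Complex.real_le_real, sub_nonneg]
      rcases σ (Sum.inl i) with k | k <;> simp
    convert hpos using 1
    have := conjTranspose_mul_self_of_partial_injection _ (hinj σ) (fun _ _ => 1)
    rw [Finset.sum_filter, Finset.sum_eq_single σ (by intro b _ hb; simp [hb]) (by simp),
      if_pos (show id σ = σ from rfl)]
    erw [this]
    ext i i'
    by_cases hii : i = i'
    · subst hii; simp
    · simp [hii]
  have key : ∀ σ, ((1 : Matrix κ κ ℂ) ⊗ₖ L σ).mulVec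
      ((K σ ⊗ₖ (1 : Matrix ι ι ℂ)).mulVec (schmidtVec p)) =
      ((√(w σ) : ℝ) : ℂ) • schmidtVec q := by
    intro σ
    ext ⟨j, j'⟩
    rw [one_kronecker_mulVec]
    have h1 : ∀ i, ((K σ ⊗ₖ (1 : Matrix ι ι ℂ)).mulVec (schmidtVec p)) (j, i) =
        if σ (Sum.inl i) = Sum.inr j then ((√(w σ * q j) : ℝ) : ℂ) else 0 := by
      intro i
      rw [kronecker_one_mulVec, Finset.sum_eq_single i]
      · simp only [K, Matrix.of_apply, schmidtVec, if_true]
        split_ifs with hs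
        · rw [← Complex.ofReal_mul, ← Real.sqrt_mul (div_nonneg (mul_nonneg (hw.1 _) (hq _)) (hp _))]
          -- Where `p i = 0` the quotient in `K` takes the default value `0`; this is right, since
          -- `hle1` forces `w σ * q j = 0`.
          by_cases hpi : p i = 0
          · have := hle1 σ (Sum.inl i)
            rw [hs] at this
            simp only [Sum.elim_inr, Sum.elim_inl, hpi] at this
            have h0 : w σ * q j = 0 := le_antisymm this (mul_nonneg (hw.1 _) (hq _))
            simp [h0]
          · rw [div_mul_cancel₀ _ hpi]
        · simp
      · intro k _ hk; simp [schmidtVec, hk]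
      · simp
    simp_rw [h1]
    simp only [L, Matrix.of_apply, Pi.smul_apply, smul_eq_mul, schmidtVec]
    rw [mul_ite, mul_zero, ← Complex.ofReal_mul, ← Real.sqrt_mul (hw.1 σ)]
    by_cases hjj : j = j'
    · subst hjj
      rw [if_pos rfl]
      rcases hx : σ.symm (Sum.inr j) with i | k
      · have hx' : σ (Sum.inl i) = Sum.inr j := by rw [← hx]; simp
        rw [Finset.sum_eq_single i]
        · simp [hx']
        · intro b _ hb
          have : σ (Sum.inl b) ≠ Sum.inr j := fun h2 => hb (hinj σ (h2.trans hx'.symm))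
          simp [this]
        · simp
      -- Here `j` comes from a padding index, where the extended `p` vanishes, so no mass is lost.
      · have hx' : σ (Sum.inr k) = Sum.inr j := by rw [← hx]; simp
        have := hle1 σ (Sum.inr k)
        rw [hx'] at this
        simp only [Sum.elim_inr] at this
        have h0 : w σ * q j = 0 := le_antisymm this (mul_nonneg (hw.1 _) (hq _))
        simp [h0]
    · rw [if_neg hjj]
      refine Finset.sum_eq_zero fun i _ => ?_
      by_cases hs : σ (Sum.inl i) = Sum.inr j
      · have : σ (Sum.inl i) ≠ Sum.inr j' := by rw [hs]; simpa using hjj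
        simp [this]
      · simp [hs]
  refine ⟨_, IsLOCCChannel.comp (IsLOCCChannel.first (b := ι) (fun _ => ()) id K hK)
    (IsLOCCChannel.second (a := κ) id (fun _ => ()) L hL), ?_⟩
  funext u
  have h2 : ∀ σ, krausMap (b' := ι) (fun _ : Equiv.Perm (ι ⊕ κ) => ()) id
      (fun σ => K σ ⊗ₖ (1 : Matrix ι ι ℂ)) (pureState (schmidtVec p)) σ =
      dyad ((K σ ⊗ₖ (1 : Matrix ι ι ℂ)).mulVec (schmidtVec p)) := by
    intro σ
    rw [← mul_dyad_mul_conjTranspose]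
    simp only [krausMap]
    rw [Finset.sum_filter, Finset.sum_eq_single σ (by intro b _ hb; simp [hb]) (by simp),
      if_pos (show id σ = σ from rfl)]
    rfl
  refine Eq.trans (b := ∑ σ, dyad (((√(w σ) : ℝ) : ℂ) • schmidtVec q)) ?_
    (sum_dyad_sqrt_smul hw _)
  refine Finset.sum_congr (by simp) fun σ _ => ?_
  rw [id, h2, mul_dyad_mul_conjTranspose, key]

/-! ### Necessity: low-rank approximation is an LOCC monotone -/

/-- A matrix read as a bipartite vector. -/
def bipartiteVec {a b : Type} (M : Matrix a b ℂ) : a × b → ℂ := fun s => M s.1 s.2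

/-- The squared Hilbert–Schmidt norm. -/
noncomputable def hsNormSq {a b : Type} [Fintype a] [Fintype b] (M : Matrix a b ℂ) : ℝ :=
  ∑ i, ∑ j, ‖M i j‖ ^ 2

theorem hsNormSq_nonneg {a b : Type} [Fintype a] [Fintype b] (M : Matrix a b ℂ) :
    0 ≤ hsNormSq M := by unfold hsNormSq; positivity

theorem hsNormSq_transpose {a b : Type} [Fintype a] [Fintype b] (M : Matrix a b ℂ) :
    hsNormSq M.transpose = hsNormSq M := Finset.sum_comm

theorem ofReal_hsNormSq {a b : Type} [Fintype a] [Fintype b] (M : Matrix a b ℂ) :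
    ((hsNormSq M : ℝ) : ℂ) = (M.conjTranspose * M).trace := by
  simp only [hsNormSq, Matrix.trace, Matrix.diag, Matrix.mul_apply, Matrix.conjTranspose_apply]
  rw [Finset.sum_comm]
  push_cast
  refine Finset.sum_congr rfl fun i _ => Finset.sum_congr rfl fun j _ => ?_
  rw [Complex.star_def, Complex.conj_mul']

open Classical in
theorem sum_hsNormSq_mul_le {a a' b X J : Type} [Fintype a] [Fintype a'] [Fintype b] [Fintype J]
    {f : J → X} {K : J → Matrix a' a ℂ} (hK : KrausConstraint f K) (x : X) (M : Matrix a b ℂ) :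
    ∑ j with f j = x, hsNormSq (K j * M) ≤ hsNormSq M := by
  have h := ((hK x).conjTranspose_mul_mul_same M).trace_nonneg
  rw [Matrix.mul_sub, Matrix.sub_mul, Matrix.trace_sub, Matrix.mul_one, sub_nonneg,
    Matrix.mul_sum, Matrix.sum_mul, Matrix.trace_sum, ← ofReal_hsNormSq] at h
  have h2 : ∀ j, (M.conjTranspose * ((K j).conjTranspose * K j) * M).trace
      = ((hsNormSq (K j * M) : ℝ) : ℂ) := by
    intro j
    rw [ofReal_hsNormSq, Matrix.conjTranspose_mul]
    simp only [Matrix.mul_assoc]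
  simp_rw [h2, ← Complex.ofReal_sum] at h
  exact Complex.real_le_real.1 h

open Classical in
/-- `ρ` is a finite mixture of pure states whose total squared distance to vectors of Schmidt rank
at most `k` is at most `ε`. -/
def HasLowRankApprox {a b X : Type} [Fintype a] [Fintype b] (k : ℕ) (ε : ℝ)
    (ρ : RegOp a b X) : Prop :=
  ∃ (I : Type) (_ : Fintype I) (x : I → X) (ψ N : I → Matrix a b ℂ),
    (∀ y, ρ y = ∑ i with x i = y, dyad (bipartiteVec (ψ i))) ∧ (∀ i, (N i).rank ≤ k) ∧
      ∑ i, hsNormSq (ψ i - N i) ≤ ε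

-- Applying the same operators to the vectors and to their approximants keeps the rank bound, and
-- `hsum` applied to the differences keeps the error bound.
open Classical in
theorem HasLowRankApprox.krausMap {a b X a' b' Y J : Type} [Fintype a] [Fintype b] [Fintype a']
    [Fintype b'] [Fintype J] {k : ℕ} {ε : ℝ} {ρ : RegOp a b X} (h : HasLowRankApprox k ε ρ)
    (f : J → X) (g : J → Y) (L : J → Matrix (a' × b') (a × b) ℂ)
    (T : J → Matrix a b ℂ →+ Matrix a' b' ℂ)
    (hLT : ∀ j M, (L j).mulVec (bipartiteVec M) = bipartiteVec (T j M))
    (hrank : ∀ j M, (T j M).rank ≤ M.rank)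
    (hsum : ∀ x M, ∑ j with f j = x, hsNormSq (T j M) ≤ hsNormSq M) :
    HasLowRankApprox k ε (krausMap f g L ρ) := by
  obtain ⟨I, _, x, ψ, N, hρ, hN, hε⟩ := h
  refine ⟨I × J, inferInstance, fun s => g s.2,
    -- The new ensemble is indexed by old member and Kraus operator; pairs whose register values
    -- disagree contribute zero vectors.
    fun s => if f s.2 = x s.1 then T s.2 (ψ s.1) else 0,
    fun s => if f s.2 = x s.1 then T s.2 (N s.1) else 0, ?_, ?_, ?_⟩
  · intro y
    have h0 : dyad (bipartiteVec (0 : Matrix a' b' ℂ)) = 0 := by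
      ext i j; simp [dyad, bipartiteVec, Matrix.vecMulVec_apply]
    simp only [BipartiteLOCC.krausMap, hρ, Matrix.mul_sum, Matrix.sum_mul,
      Finset.sum_filter, Fintype.sum_prod_type]
    rw [Finset.sum_comm]
    refine Finset.sum_congr rfl fun j _ => ?_
    split_ifs with hj
    · refine Finset.sum_congr rfl fun i _ => ?_
      by_cases hi : x i = f j
      · simp [hi, mul_dyad_mul_conjTranspose, hLT]
      · simp [hi, Ne.symm hi, h0]
    · simp
  · rintro ⟨i, j⟩
    dsimp only
    split_ifs
    · exact (hrank _ _).trans (hN i)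
    · simp
  · refine le_trans ?_ hε
    rw [Fintype.sum_prod_type]
    refine Finset.sum_le_sum fun i _ => ?_
    refine le_trans (le_of_eq ?_) (hsum (x i) (ψ i - N i))
    rw [Finset.sum_filter]
    refine Finset.sum_congr rfl fun j _ => ?_
    by_cases hj : f j = x i
    · simp only [hj, if_true, map_sub]
    · simp [hj, hsNormSq]

open Classical in
theorem IsLOCCChannel.hasLowRankApprox {a b X a' b' Y : Type} [Fintype a] [Fintype b] [Fintype X]
    [Fintype a'] [Fintype b'] [Fintype Y] {Λ : RegOp a b X → RegOp a' b' Y}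
    (hΛ : IsLOCCChannel Λ) {k : ℕ} {ε : ℝ} :
    ∀ {ρ : RegOp a b X}, HasLowRankApprox k ε ρ → HasLowRankApprox k ε (Λ ρ) := by
  induction hΛ with
  | @first a b X a' Y J _ _ _ _ _ _ f g K hK =>
    intro ρ h
    refine h.krausMap f g _ (fun j => ⟨⟨fun M => K j * M, by simp⟩, by simp [Matrix.mul_add]⟩)
      ?_ ?_ ?_
    · intro j M
      ext ⟨i, l⟩
      rw [kronecker_one_mulVec]
      simp [bipartiteVec, Matrix.mul_apply]
    · intro j M
      exact Matrix.rank_mul_le_right _ _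
    · intro x M
      exact sum_hsNormSq_mul_le hK x M
  | @second a b X b' Y J _ _ _ _ _ _ f g K hK =>
    intro ρ h
    refine h.krausMap f g _
      (fun j => ⟨⟨fun M => M * (K j).transpose, by simp⟩, by simp [Matrix.add_mul]⟩) ?_ ?_ ?_
    · intro j M
      ext ⟨i, l⟩
      rw [one_kronecker_mulVec]
      simp [bipartiteVec, Matrix.mul_apply, mul_comm]
    · intro j M
      exact Matrix.rank_mul_le_left _ _
    · intro x M
      have := sum_hsNormSq_mul_le hK x M.transpose
      rw [hsNormSq_transpose] at this
      refine le_trans (le_of_eq ?_) this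
      refine Finset.sum_congr rfl fun j _ => ?_
      rw [← hsNormSq_transpose]
      simp [Matrix.transpose_mul]
  | comp h₁ h₂ ih₁ ih₂ =>
    intro ρ h
    exact ih₂ (ih₁ h)

/-- A pure state is extremal, so every member of an ensemble realizing it is proportional to it;
comparing one diagonal entry normalizes the coefficients. -/
theorem exists_smul_of_sum_dyad_eq {n I : Type} [Fintype I] {φ : n → ℂ} {ψ : I → n → ℂ}
    (hφ : φ ≠ 0) (h : ∑ i, dyad (ψ i) = dyad φ) :
    ∃ c : I → ℂ, (∀ i, ψ i = c i • φ) ∧ ∑ i, ‖c i‖ ^ 2 = 1 := by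
  obtain ⟨s₀, hs₀⟩ := Function.ne_iff.1 hφ
  simp only [Pi.zero_apply] at hs₀
  have hent : ∀ s t, ∑ i, ψ i s * star (ψ i t) = φ s * star (φ t) := by
    intro s t
    have := congrFun (congrFun h s) t
    simpa [Matrix.sum_apply, dyad, Matrix.vecMulVec_apply] using this
  have hcol : ∀ i s, φ s₀ * ψ i s = φ s * ψ i s₀ := by
    intro i s
    -- The sum of squared `2 × 2` minors of `(φ, ψ i)` depends only on `∑ i, dyad (ψ i)`, hence
    -- vanishes.
    have h0 : ∑ i, (φ s₀ * ψ i s - φ s * ψ i s₀) * star (φ s₀ * ψ i s - φ s * ψ i s₀) = 0 := by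
      have : ∀ i, (φ s₀ * ψ i s - φ s * ψ i s₀) * star (φ s₀ * ψ i s - φ s * ψ i s₀) =
          φ s₀ * star (φ s₀) * (ψ i s * star (ψ i s)) - φ s₀ * star (φ s) * (ψ i s * star (ψ i s₀))
          - φ s * star (φ s₀) * (ψ i s₀ * star (ψ i s))
          + φ s * star (φ s) * (ψ i s₀ * star (ψ i s₀)) := by
        intro i; simp only [star_sub, star_mul']; ring
      simp_rw [this, Finset.sum_add_distrib, Finset.sum_sub_distrib, ← Finset.mul_sum, hent]
      ring
    have h1 : ∑ i, ‖φ s₀ * ψ i s - φ s * ψ i s₀‖ ^ 2 = 0 := by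
      have : ((∑ i, ‖φ s₀ * ψ i s - φ s * ψ i s₀‖ ^ 2 : ℝ) : ℂ) = 0 := by
        rw [← h0]
        push_cast
        refine Finset.sum_congr rfl fun i _ => ?_
        rw [Complex.star_def, Complex.mul_conj']
      exact_mod_cast this
    have h2 := (Finset.sum_eq_zero_iff_of_nonneg (fun i _ => by positivity)).1 h1 i
      (Finset.mem_univ i)
    exact sub_eq_zero.1 (norm_eq_zero.1 (pow_eq_zero_iff two_ne_zero |>.1 h2))
  refine ⟨fun i => ψ i s₀ / φ s₀, fun i => ?_, ?_⟩
  · ext s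
    have := hcol i s
    simp only [Pi.smul_apply, smul_eq_mul]
    field_simp
    linear_combination this
  · have h1 := hent s₀ s₀
    have h2 : ∑ i, ‖ψ i s₀‖ ^ 2 = ‖φ s₀‖ ^ 2 := by
      have : ((∑ i, ‖ψ i s₀‖ ^ 2 : ℝ) : ℂ) = ((‖φ s₀‖ ^ 2 : ℝ) : ℂ) := by
        push_cast
        simp only [Complex.star_def, Complex.mul_conj'] at h1
        exact h1
      exact_mod_cast this
    simp_rw [norm_div, div_pow]
    rw [← Finset.sum_div, h2, div_self (by simpa using hs₀)]

/-- Both sides are the trace of the orthogonal projection onto `V`. -/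
theorem sum_norm_sq_starProjection_single {κ : Type} [Fintype κ] [DecidableEq κ]
    (V : Submodule ℂ (EuclideanSpace ℂ κ)) :
    ∑ j, ‖V.starProjection (EuclideanSpace.single j 1)‖ ^ 2 = Module.finrank ℂ V := by
  let b := stdOrthonormalBasis ℂ V
  have h1 : ∀ j, ‖V.starProjection (EuclideanSpace.single j (1 : ℂ))‖ ^ 2 =
      ∑ l, ‖(b l : EuclideanSpace ℂ κ) j‖ ^ 2 := by
    intro j
    have := b.sum_sq_norm_inner_right (V.orthogonalProjectionOnto (EuclideanSpace.single j (1 : ℂ)))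
    rw [Submodule.starProjection_apply, Submodule.norm_coe, ← this]
    refine Finset.sum_congr rfl fun l _ => ?_
    rw [Submodule.coe_inner, ← Submodule.starProjection_apply,
      ← Submodule.inner_starProjection_left_eq_right]
    simp [EuclideanSpace.inner_single_right]
  simp_rw [h1]
  rw [Finset.sum_comm]
  have h2 : ∀ l, ∑ j, ‖(b l : EuclideanSpace ℂ κ) j‖ ^ 2 = 1 := by
    intro l
    rw [← EuclideanSpace.norm_sq_eq, Submodule.norm_coe, b.orthonormal.1 l]
    norm_num
  simp [h2]

-- Let `π j` be the squared norm of the projection of the `j`-th basis vector to the column space of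
-- `N`. Column `j` has squared error at least `‖c‖ ^ 2 * q j * (1 - π j)`, while `∑ π j ≤ k`.
open Classical in
theorem norm_sq_mul_truncSum_le {κ : Type} [Fintype κ] {q : κ → ℝ} (hq : ∀ j, 0 ≤ q j) {k : ℕ}
    {N : Matrix κ κ ℂ} (hN : N.rank ≤ k) (c : ℂ) {t : ℝ} (ht : 0 ≤ t) :
    ‖c‖ ^ 2 * truncSum q t ≤
      hsNormSq (c • Matrix.diagonal (fun j => ((√(q j) : ℝ) : ℂ)) - N) + ‖c‖ ^ 2 * (k * t) := by
  let V : Submodule ℂ (EuclideanSpace ℂ κ) := (Submodule.span ℂ (Set.range N.col)).map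
    ((WithLp.linearEquiv 2 ℂ (κ → ℂ)).symm : (κ → ℂ) →ₗ[ℂ] EuclideanSpace ℂ κ)
  have hV : Module.finrank ℂ V ≤ k := by
    rw [LinearEquiv.finrank_map_eq, ← Matrix.rank_eq_finrank_span_cols]; exact hN
  let π : κ → ℝ := fun j => ‖V.starProjection (EuclideanSpace.single j (1 : ℂ))‖ ^ 2
  have hπ0 : ∀ j, 0 ≤ π j := fun j => by positivity
  have hπ1 : ∀ j, π j + ‖Vᗮ.starProjection (EuclideanSpace.single j (1 : ℂ))‖ ^ 2 = 1 := by
    intro j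
    rw [← Submodule.norm_sq_eq_add_norm_sq_starProjection]
    simp
  have hπs : ∑ j, π j ≤ k := by
    rw [sum_norm_sq_starProjection_single]; exact_mod_cast hV
  have hcol : ∀ j, ‖c‖ ^ 2 * (q j * (1 - π j)) ≤
      ∑ i, ‖(c • Matrix.diagonal (fun j => ((√(q j) : ℝ) : ℂ)) - N) i j‖ ^ 2 := by
    intro j
    set v : EuclideanSpace ℂ κ := WithLp.toLp 2 (N.col j) with hv
    have hvV : v ∈ V := ⟨N.col j, Submodule.subset_span ⟨j, rfl⟩, rfl⟩
    set e : EuclideanSpace ℂ κ := EuclideanSpace.single j (1 : ℂ) with he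
    have e1 : ∑ i, ‖(c • Matrix.diagonal (fun j => ((√(q j) : ℝ) : ℂ)) - N) i j‖ ^ 2 =
        ‖(c * ((√(q j) : ℝ) : ℂ)) • e - v‖ ^ 2 := by
      rw [EuclideanSpace.norm_sq_eq]
      refine Finset.sum_congr rfl fun i _ => ?_
      by_cases hij : i = j
      · subst hij; simp [he, hv]
      · simp [he, hv, hij]
    have e2 : Vᗮ.starProjection ((c * ((√(q j) : ℝ) : ℂ)) • e - v) =
        (c * ((√(q j) : ℝ) : ℂ)) • Vᗮ.starProjection e := by
      rw [map_sub, map_smul]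
      have : Vᗮ.starProjection v = 0 := by
        rw [Submodule.starProjection_apply_eq_zero_iff]
        exact Submodule.le_orthogonal_orthogonal V hvV
      rw [this, sub_zero]
    rw [e1, Submodule.norm_sq_eq_add_norm_sq_starProjection _ V, e2, norm_smul, mul_pow, norm_mul,
      mul_pow]
    have e3 : 1 - π j = ‖Vᗮ.starProjection e‖ ^ 2 := by rw [← hπ1 j]; ring
    have e4 : ‖((√(q j) : ℝ) : ℂ)‖ ^ 2 = q j := by
      rw [Complex.norm_real, Real.norm_eq_abs, sq_abs, Real.sq_sqrt (hq j)]
    rw [e3, e4]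
    have : 0 ≤ ‖V.starProjection ((c * ((√(q j) : ℝ) : ℂ)) • e - v)‖ ^ 2 := by positivity
    linarith
  -- A minimum is at most the convex combination with weights `1 - π j` and `π j`.
  have hmin : truncSum q t ≤ ∑ j, q j * (1 - π j) + t * ∑ j, π j := by
    rw [Finset.mul_sum, ← Finset.sum_add_distrib]
    refine Finset.sum_le_sum fun j _ => ?_
    have h1 : 0 ≤ 1 - π j := by
      have := hπ1 j
      have h2 : 0 ≤ ‖Vᗮ.starProjection (EuclideanSpace.single j (1 : ℂ))‖ ^ 2 := by positivity
      linarith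
    have h3 := mul_le_mul_of_nonneg_right (min_le_left (q j) t) h1
    have h4 := mul_le_mul_of_nonneg_right (min_le_right (q j) t) (hπ0 j)
    linarith
  have hhs : ‖c‖ ^ 2 * ∑ j, q j * (1 - π j) ≤
      hsNormSq (c • Matrix.diagonal (fun j => ((√(q j) : ℝ) : ℂ)) - N) := by
    rw [hsNormSq, Finset.sum_comm, Finset.mul_sum]
    exact Finset.sum_le_sum fun j _ => hcol j
  have h5 : t * ∑ j, π j ≤ k * t := by
    rw [mul_comm]; exact mul_le_mul_of_nonneg_right hπs ht
  have h6 := mul_le_mul_of_nonneg_left (hmin.trans (add_le_add_right h5 _)) (sq_nonneg ‖c‖)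
  linarith

open Classical in
theorem schmidtVec_eq_bipartiteVec {ι : Type} (p : ι → ℝ) :
    schmidtVec p = bipartiteVec (Matrix.diagonal fun i => ((√(p i) : ℝ) : ℂ)) := by
  ext ⟨i, j⟩
  simp [schmidtVec, bipartiteVec, Matrix.diagonal_apply]

theorem bipartiteVec_injective {a b : Type} :
    Function.Injective (bipartiteVec : Matrix a b ℂ → a × b → ℂ) := by
  intro M N h
  ext i j
  exact congrFun h (i, j)

theorem HasLowRankApprox.truncSum_le {κ : Type} [Fintype κ] {q : κ → ℝ} (hq : ∀ j, 0 ≤ q j)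
    {k : ℕ} {ε : ℝ} (h : HasLowRankApprox k ε (pureState (schmidtVec q))) {t : ℝ} (ht : 0 ≤ t) :
    truncSum q t ≤ ε + k * t := by
  classical
  obtain ⟨I, _, x, ψ, N, hρ, hN, hε⟩ := h
  have h0 : 0 ≤ ε := (Finset.sum_nonneg fun i _ => hsNormSq_nonneg _).trans hε
  -- The zero vector does not determine coefficients of total weight one, so it is treated apart.
  by_cases hφ : schmidtVec q = 0
  · have hq0 : ∀ j, q j = 0 := by
      intro j
      have := congrFun hφ (j, j)
      simp only [schmidtVec, if_true, Pi.zero_apply, Complex.ofReal_eq_zero] at this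
      exact (Real.sqrt_eq_zero (hq j)).1 this
    simp only [truncSum, hq0, min_eq_left ht, Finset.sum_const_zero]
    positivity
  have h1 : ∑ i, dyad (bipartiteVec (ψ i)) = dyad (schmidtVec q) := by
    rw [show dyad (schmidtVec q) = pureState (schmidtVec q) () from rfl, hρ ()]
    simp
  obtain ⟨c, hc, hc1⟩ := exists_smul_of_sum_dyad_eq hφ h1
  have h2 : ∀ i, ψ i = c i • Matrix.diagonal fun j => ((√(q j) : ℝ) : ℂ) := by
    intro i
    apply bipartiteVec_injective
    rw [hc i, schmidtVec_eq_bipartiteVec]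
    rfl
  have h3 : ∑ i, ‖c i‖ ^ 2 * truncSum q t ≤
      ∑ i, (hsNormSq (ψ i - N i) + ‖c i‖ ^ 2 * (k * t)) := by
    refine Finset.sum_le_sum fun i _ => ?_
    rw [h2 i]
    exact norm_sq_mul_truncSum_le hq (hN i) (c i) ht
  rw [← Finset.sum_mul, Finset.sum_add_distrib, ← Finset.sum_mul, hc1] at h3
  linarith

/-- Keeping exactly the entries above `t` costs `t` for each kept entry and the entry itself for
each dropped one. -/
theorem exists_hasLowRankApprox_schmidtVec {ι : Type} [Fintype ι] {p : ι → ℝ}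
    (hp : ∀ i, 0 ≤ p i) (t : ℝ) :
    ∃ (k : ℕ) (ε : ℝ), HasLowRankApprox k ε (pureState (schmidtVec p)) ∧
      ε + k * t = truncSum p t := by
  classical
  refine ⟨(Finset.univ.filter fun i => t < p i).card, ∑ i with ¬ t < p i, p i, ?_, ?_⟩
  · refine ⟨Unit, inferInstance, fun _ => (),
      fun _ => Matrix.diagonal fun i => ((√(p i) : ℝ) : ℂ),
      fun _ => Matrix.diagonal fun i => if t < p i then ((√(p i) : ℝ) : ℂ) else 0, ?_, ?_, ?_⟩
    · intro y
      rw [pureState, schmidtVec_eq_bipartiteVec]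
      simp [dyad]
    · intro _
      rw [Matrix.rank_diagonal, Fintype.card_subtype]
      refine Finset.card_le_card fun i => ?_
      simp only [Finset.mem_filter, Finset.mem_univ, true_and]
      intro h; by_contra h'; simp [h'] at h
    · rw [Finset.univ_unique, Finset.sum_singleton, Finset.sum_filter, hsNormSq]
      refine Finset.sum_le_sum fun i _ => ?_
      rw [Finset.sum_eq_single i]
      · by_cases h : t < p i
        · simp [h]
        · simp [h, Real.sq_sqrt (hp i)]
      · intro j _ hj; simp [hj.symm]
      · simp
  · rw [truncSum, ← Finset.sum_filter_add_sum_filter_not Finset.univ (fun i => t < p i), add_comm]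
    congr 1
    · rw [← nsmul_eq_mul, ← Finset.sum_const]
      refine Finset.sum_congr rfl fun i hi => (min_eq_right ?_).symm
      exact (Finset.mem_filter.1 hi).2.le
    · refine Finset.sum_congr rfl fun i hi => (min_eq_left ?_).symm
      exact not_lt.1 (Finset.mem_filter.1 hi).2

theorem LOCCConvertible.truncSum_le {ι κ : Type} [Fintype ι] [Fintype κ] {p : ι → ℝ} {q : κ → ℝ}
    (hp : ∀ i, 0 ≤ p i) (hq : ∀ j, 0 ≤ q j)
    (h : LOCCConvertible (schmidtVec p) (schmidtVec q)) {t : ℝ} (ht : 0 ≤ t) :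
    truncSum q t ≤ truncSum p t := by
  obtain ⟨Λ, hΛ, hΛp⟩ := h
  obtain ⟨k, ε, hk, hε⟩ := exists_hasLowRankApprox_schmidtVec hp t
  rw [← hε]
  refine HasLowRankApprox.truncSum_le hq ?_ ht
  rw [← hΛp]
  exact hΛ.hasLowRankApprox hk

/-! ### From threshold sums to power sums -/

/-- Split at `t = x`. The condition `0 < α` gives convergence at zero, and `α < 1` at infinity. -/
theorem min_mul_rpow_integral {α x : ℝ} (h0 : 0 < α) (h1 : α < 1) (hx : 0 ≤ x) :
    IntegrableOn (fun t : ℝ => min x t * t ^ (α - 2)) (Set.Ioi 0) ∧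
      ∫ t in Set.Ioi 0, min x t * t ^ (α - 2) = (1 / α + 1 / (1 - α)) * x ^ α := by
  rcases hx.eq_or_lt with rfl | hx
  · have h : Set.EqOn (fun t : ℝ => min 0 t * t ^ (α - 2)) 0 (Set.Ioi 0) := fun t ht => by
      simp [min_eq_left (Set.mem_Ioi.1 ht).le]
    refine ⟨(integrableOn_congr_fun h measurableSet_Ioi).2 integrableOn_zero, ?_⟩
    rw [setIntegral_congr_fun measurableSet_Ioi h, Real.zero_rpow h0.ne']
    simp
  have e1 : Set.EqOn (fun t : ℝ => t ^ (α - 1)) (fun t : ℝ => min x t * t ^ (α - 2))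
      (Set.Ioc 0 x) := by
    intro t ht
    simp only [min_eq_right ht.2]
    rw [show α - 1 = 1 + (α - 2) by ring, Real.rpow_add ht.1, Real.rpow_one]
  have e2 : Set.EqOn (fun t : ℝ => x * t ^ (α - 2)) (fun t : ℝ => min x t * t ^ (α - 2))
      (Set.Ioi x) := by
    intro t ht
    simp only [min_eq_left (Set.mem_Ioi.1 ht).le]
  have i1 : IntegrableOn (fun t : ℝ => t ^ (α - 1)) (Set.Ioc 0 x) :=
    (intervalIntegrable_iff_integrableOn_Ioc_of_le hx.le).1
      (intervalIntegral.intervalIntegrable_rpow' (by linarith))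
  have i2 : IntegrableOn (fun t : ℝ => x * t ^ (α - 2)) (Set.Ioi x) :=
    (integrableOn_Ioi_rpow_of_lt (by linarith) hx).const_mul x
  have i1' := (integrableOn_congr_fun e1 measurableSet_Ioc).1 i1
  have i2' := (integrableOn_congr_fun e2 measurableSet_Ioi).1 i2
  rw [← Set.Ioc_union_Ioi_eq_Ioi hx.le]
  refine ⟨i1'.union i2', ?_⟩
  rw [setIntegral_union (Set.Ioc_disjoint_Ioi le_rfl) measurableSet_Ioi i1' i2',
    ← setIntegral_congr_fun measurableSet_Ioc e1,
    ← setIntegral_congr_fun measurableSet_Ioi e2, integral_const_mul,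
    integral_Ioi_rpow_of_lt (by linarith) hx, ← intervalIntegral.integral_of_le hx.le,
    integral_rpow (Or.inl (by linarith))]
  have e3 : x ^ α = x * x ^ (α - 1) := by
    rw [show α = 1 + (α - 1) by ring, Real.rpow_add hx, Real.rpow_one]; ring_nf
  rw [show α - 1 + 1 = α by ring, show α - 2 + 1 = α - 1 by ring, Real.zero_rpow h0.ne', sub_zero,
    e3]
  have : α - 1 ≠ 0 := by linarith
  have : 1 - α ≠ 0 := by linarith
  field_simp
  ring

/-- Domination of the threshold sums implies domination of the power sums of order in `(0, 1)`. -/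
theorem sum_rpow_le_of_truncSum_le {ι κ : Type} [Fintype ι] [Fintype κ] {p : ι → ℝ} {q : κ → ℝ}
    (hp : ∀ i, 0 ≤ p i) (hq : ∀ j, 0 ≤ q j) (h : ∀ t, 0 ≤ t → truncSum q t ≤ truncSum p t)
    {α : ℝ} (h0 : 0 < α) (h1 : α < 1) : ∑ j, q j ^ α ≤ ∑ i, p i ^ α := by
  have key : ∀ {κ : Type} [Fintype κ] (q : κ → ℝ), (∀ j, 0 ≤ q j) →
      IntegrableOn (fun t : ℝ => truncSum q t * t ^ (α - 2)) (Set.Ioi 0) ∧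
      ∫ t in Set.Ioi 0, truncSum q t * t ^ (α - 2) =
        (1 / α + 1 / (1 - α)) * ∑ j, q j ^ α := by
    intro κ _ q hq
    simp only [truncSum, Finset.sum_mul]
    refine ⟨integrable_finsetSum _ fun j _ => (min_mul_rpow_integral h0 h1 (hq j)).1, ?_⟩
    rw [integral_finsetSum _ fun j _ => (min_mul_rpow_integral h0 h1 (hq j)).1, Finset.mul_sum]
    exact Finset.sum_congr rfl fun j _ => (min_mul_rpow_integral h0 h1 (hq j)).2
  have hle := setIntegral_mono_on (key q hq).1 (key p hp).1 measurableSet_Ioi fun t ht =>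
    mul_le_mul_of_nonneg_right (h t (Set.mem_Ioi.1 ht).le)
      (Real.rpow_nonneg (Set.mem_Ioi.1 ht).le (α - 2))
  rw [(key q hq).2, (key p hp).2] at hle
  have : 0 < 1 / α + 1 / (1 - α) := by
    have : 0 < 1 - α := by linarith
    positivity
  exact le_of_mul_le_mul_left hle this

/-! ### Power sums and Rényi entropies -/

/-- The power sum `∑ p_i ^ α` over the support. -/
noncomputable def powSum {d : ℕ} (α : ℝ) (P : Fin d → ℝ) : ℝ := ∑ i with P i ≠ 0, P i ^ α

section

variable {d : ℕ} {P : Fin d → ℝ}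

theorem sum_support (hP : P ∈ stdSimplex ℝ (Fin d)) : ∑ i with P i ≠ 0, P i = 1 := by
  rw [Finset.sum_filter_ne_zero, hP.2]

theorem pos_of_mem_support (hP : P ∈ stdSimplex ℝ (Fin d)) {i : Fin d}
    (hi : i ∈ Finset.univ.filter fun i => P i ≠ 0) : 0 < P i :=
  lt_of_le_of_ne (hP.1 i) (Finset.mem_filter.1 hi).2.symm

theorem le_one_of_mem_stdSimplex (hP : P ∈ stdSimplex ℝ (Fin d)) (i : Fin d) : P i ≤ 1 :=
  hP.2 ▸ Finset.single_le_sum (fun j _ => hP.1 j) (Finset.mem_univ i)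

theorem support_nonempty (hP : P ∈ stdSimplex ℝ (Fin d)) :
    (Finset.univ.filter fun i => P i ≠ 0).Nonempty := by
  by_contra h
  have := sum_support hP
  rw [Finset.not_nonempty_iff_eq_empty.1 h] at this
  simp at this

theorem powSum_pos (hP : P ∈ stdSimplex ℝ (Fin d)) (α : ℝ) : 0 < powSum α P :=
  Finset.sum_pos (fun _ hi => Real.rpow_pos_of_pos (pos_of_mem_support hP hi) α)
    (support_nonempty hP)

theorem powSum_one (hP : P ∈ stdSimplex ℝ (Fin d)) : powSum 1 P = 1 := by
  simp only [powSum, Real.rpow_one]; exact sum_support hP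

theorem hasDerivAt_powSum (hP : P ∈ stdSimplex ℝ (Fin d)) (α : ℝ) :
    HasDerivAt (fun α => powSum α P) (∑ i with P i ≠ 0, P i ^ α * Real.log (P i)) α := by
  unfold powSum
  exact HasDerivAt.fun_sum fun i hi =>
    (Real.hasStrictDerivAt_const_rpow (pos_of_mem_support hP hi) α).hasDerivAt

/-- Since `log Z_1 = 0`, the entropy is minus a difference quotient based at `1`, with Shannon
entropy as its derivative value. Continuity at `α = 1` follows. -/
theorem renyiEntropy_eq_neg_dslope (hP : P ∈ stdSimplex ℝ (Fin d)) (α : ℝ) :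
    renyiEntropy α P = -dslope (fun a => Real.logb 2 (powSum a P)) 1 α := by
  by_cases h : α = 1
  · subst h
    have hd : HasDerivAt (fun a => Real.logb 2 (powSum a P))
        ((∑ i with P i ≠ 0, P i ^ (1 : ℝ) * Real.log (P i)) / powSum 1 P / Real.log 2) 1 :=
      ((hasDerivAt_powSum hP 1).log (powSum_pos hP 1).ne').div_const _
    rw [dslope_same, hd.deriv, powSum_one hP, div_one, renyiEntropy, if_pos rfl]
    congr 1
    rw [Finset.sum_filter, Finset.sum_div]
    refine Finset.sum_congr rfl fun i _ => ?_
    split_ifs with hi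
    · simp [Real.logb, mul_div_assoc]
    · have : P i = 0 := not_not.1 hi
      simp [this]
  · rw [dslope_of_ne _ h, slope_def_field, powSum_one hP, Real.logb_one, sub_zero, renyiEntropy,
      if_neg h, powSum]
    have h1 : 1 - α ≠ 0 := sub_ne_zero.2 (Ne.symm h)
    have h2 : α - 1 ≠ 0 := sub_ne_zero.2 h
    field_simp
    ring

theorem continuous_renyiEntropy (hP : P ∈ stdSimplex ℝ (Fin d)) :
    Continuous fun α => renyiEntropy α P := by
  simp_rw [renyiEntropy_eq_neg_dslope hP]
  have hd : Differentiable ℝ fun a => Real.logb 2 (powSum a P) := fun a =>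
    (((hasDerivAt_powSum hP a).log (powSum_pos hP a).ne').div_const _).differentiableAt
  refine Continuous.neg (continuous_iff_continuousAt.2 fun α => ?_)
  by_cases h : α = 1
  · subst h; exact continuousAt_dslope_same.2 (hd 1)
  · exact (continuousAt_dslope_of_ne h).2 (hd α).continuousAt

theorem log_powSum (α : ℝ) (h : α ≠ 1) :
    Real.log (powSum α P) = (1 - α) * (renyiEntropy α P * Real.log 2) := by
  have h1 : 1 - α ≠ 0 := sub_ne_zero.2 (Ne.symm h)
  have h2 : Real.log 2 ≠ 0 := (Real.log_pos one_lt_two).ne'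
  rw [renyiEntropy, if_neg h, powSum, Real.logb]
  field_simp

theorem renyiEntropy_one_mul_log :
    renyiEntropy 1 P * Real.log 2 = ∑ i with P i ≠ 0, P i * -Real.log (P i) := by
  have h2 : Real.log 2 ≠ 0 := (Real.log_pos one_lt_two).ne'
  rw [renyiEntropy, if_pos rfl, Finset.sum_filter, neg_mul, Finset.sum_mul,
    ← Finset.sum_neg_distrib]
  refine Finset.sum_congr rfl fun i _ => ?_
  split_ifs with hi
  · rw [Real.logb]; field_simp
  · simp [not_not.1 hi]

theorem one_le_powSum (hP : P ∈ stdSimplex ℝ (Fin d)) {α : ℝ} (h : α ≤ 1) : 1 ≤ powSum α P := by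
  rw [← sum_support hP]
  refine Finset.sum_le_sum fun i hi => ?_
  simpa using Real.rpow_le_rpow_of_exponent_ge (pos_of_mem_support hP hi)
    (le_one_of_mem_stdSimplex hP i) h

theorem renyiEntropy_nonneg (hP : P ∈ stdSimplex ℝ (Fin d)) {α : ℝ} (h : α ≤ 1) :
    0 ≤ renyiEntropy α P := by
  have h2 := Real.log_pos one_lt_two
  rcases h.eq_or_lt with rfl | h
  · refine nonneg_of_mul_nonneg_left ?_ h2
    rw [renyiEntropy_one_mul_log]
    refine Finset.sum_nonneg fun i hi => mul_nonneg (hP.1 i) ?_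
    exact neg_nonneg.2 (Real.log_nonpos (hP.1 i) (le_one_of_mem_stdSimplex hP i))
  · have := Real.log_nonneg (one_le_powSum hP h.le)
    rw [log_powSum α h.ne] at this
    exact nonneg_of_mul_nonneg_left (nonneg_of_mul_nonneg_right this (by linarith)) h2

theorem renyiEntropy_pos (hP : P ∈ stdSimplex ℝ (Fin d)) (hne : ∀ j, P j ≠ 1) {α : ℝ}
    (h : α ≤ 1) : 0 < renyiEntropy α P := by
  have h2 := Real.log_pos one_lt_two
  have hlt : ∀ i, P i < 1 := fun i => lt_of_le_of_ne (le_one_of_mem_stdSimplex hP i) (hne i)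
  rcases h.eq_or_lt with rfl | h
  · refine pos_of_mul_pos_left ?_ h2.le
    rw [renyiEntropy_one_mul_log]
    refine Finset.sum_pos (fun i hi => mul_pos (pos_of_mem_support hP hi) ?_) (support_nonempty hP)
    exact neg_pos.2 (Real.log_neg (pos_of_mem_support hP hi) (hlt i))
  · have : 1 < powSum α P := by
      rw [← sum_support hP]
      refine Finset.sum_lt_sum_of_nonempty (support_nonempty hP) fun i hi => ?_
      simpa using Real.rpow_lt_rpow_of_exponent_gt (pos_of_mem_support hP hi) (hlt i) h
    have := Real.log_pos this
    rw [log_powSum α h.ne] at this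
    exact pos_of_mul_pos_left (pos_of_mul_pos_right this (by linarith)) h2.le

end

/-! ### Tensor powers and the upper bound on rates -/

/-- The probabilities of words of length `n` with independent letters of law `P`. -/
def powDist {ι : Type} (P : ι → ℝ) (n : ℕ) : (Fin n → ι) → ℝ := fun x => ∏ k, P (x k)

theorem powDist_nonneg {ι : Type} {P : ι → ℝ} (hP : ∀ i, 0 ≤ P i) (n : ℕ) (x : Fin n → ι) :
    0 ≤ powDist P n x := Finset.prod_nonneg fun _ _ => hP _

theorem sum_piFinset_powDist {ι : Type} (P : ι → ℝ) (n : ℕ) (S : Finset ι) :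
    ∑ x ∈ Fintype.piFinset fun _ : Fin n => S, powDist P n x = (∑ i ∈ S, P i) ^ n := by
  simp only [powDist]
  rw [Finset.sum_prod_piFinset S fun _ i => P i]
  simp

theorem sum_powDist {ι : Type} [Fintype ι] (P : ι → ℝ) (n : ℕ) :
    ∑ x, powDist P n x = (∑ i, P i) ^ n := by
  classical
  rw [← sum_piFinset_powDist, Fintype.piFinset_univ]

theorem tensorPow_schmidtState {d : ℕ} {P : Fin d → ℝ} (hP : ∀ i, 0 ≤ P i) (n : ℕ) :
    tensorPow (schmidtState P) n = schmidtVec (powDist P n) := by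
  ext ⟨x, y⟩
  simp only [tensorPow, schmidtState, schmidtVec, powDist]
  split_ifs with h
  · subst h
    simp only [if_true]
    rw [← Complex.ofReal_prod, Real.sqrt_prod _ fun i _ => hP (x i)]
  · obtain ⟨k, hk⟩ := Function.ne_iff.1 h
    exact Finset.prod_eq_zero (Finset.mem_univ k) (by simp [hk])

theorem sqrt_smul_schmidtVec {κ : Type} {p : ℝ} (hp : 0 ≤ p) (q : κ → ℝ) :
    ((√p : ℝ) : ℂ) • schmidtVec q = schmidtVec fun j => p * q j := by
  ext s
  simp only [schmidtVec, Pi.smul_apply, smul_eq_mul, mul_ite, mul_zero]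
  rw [Real.sqrt_mul hp, Complex.ofReal_mul]

/-- Extraction from powers of Schmidt states is governed by the threshold sums. -/
theorem extractsWithProb_iff {d₁ d₂ : ℕ} {P : Fin d₁ → ℝ} {Q : Fin d₂ → ℝ} (hP : ∀ i, 0 ≤ P i)
    (hQ : ∀ j, 0 ≤ Q j) (n m : ℕ) (p : ℝ) :
    ExtractsWithProb (tensorPow (schmidtState P) n) (tensorPow (schmidtState Q) m) p ↔
      0 ≤ p ∧ ∀ t, 0 ≤ t →
        truncSum (fun y => p * powDist Q m y) t ≤ truncSum (powDist P n) t := by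
  refine and_congr_right fun hp => ?_
  rw [tensorPow_schmidtState hP, tensorPow_schmidtState hQ, sqrt_smul_schmidtVec hp]
  have h2 : ∀ y, 0 ≤ p * powDist Q m y := fun y => mul_nonneg hp (powDist_nonneg hQ m y)
  exact ⟨fun h t ht => h.truncSum_le (powDist_nonneg hP n) h2 ht,
    fun h => loccConvertible_schmidtVec (powDist_nonneg hP n) h2 h⟩

/-- Positivity of `α` matters: at order `0` words of probability zero would count, because `0 ^ 0 =
1`. -/
theorem sum_rpow_powDist {d : ℕ} {P : Fin d → ℝ} (hP : ∀ i, 0 ≤ P i) {α : ℝ} (h0 : 0 < α)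
    (n : ℕ) : ∑ x, powDist P n x ^ α = powSum α P ^ n := by
  have h1 : ∀ x, powDist P n x ^ α = powDist (fun i => P i ^ α) n x := fun x =>
    (Real.finsetProd_rpow _ _ (fun i _ => hP (x i)) α).symm
  simp_rw [h1]
  rw [sum_powDist, powSum, Finset.sum_filter]
  congr 1
  refine Finset.sum_congr rfl fun i _ => ?_
  split_ifs with h
  · rfl
  · rw [not_not.1 h, Real.zero_rpow h0.ne']

/-- Every achievable rate is at most the ratio of the Rényi entropies of order in `(0, 1)`. -/
theorem IsAchievableRate.mul_renyiEntropy_le {d₁ d₂ : ℕ} {P : Fin d₁ → ℝ} {Q : Fin d₂ → ℝ}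
    (hP : P ∈ stdSimplex ℝ (Fin d₁)) (hQ : Q ∈ stdSimplex ℝ (Fin d₂)) {τ : ℝ}
    (h : IsAchievableRate (schmidtState P) (schmidtState Q) τ) {α : ℝ} (h0 : 0 < α) (h1 : α < 1) :
    τ * renyiEntropy α Q ≤ renyiEntropy α P := by
  obtain ⟨hτ, p, hp, hev⟩ := h
  have hev2 : ∀ᶠ n : ℕ in atTop, α * Real.log (p n) / n +
      (⌊τ * n⌋₊ : ℝ) / n * Real.log (powSum α Q) ≤ Real.log (powSum α P) := by
    filter_upwards [hev, hp.eventually (lt_mem_nhds one_pos), eventually_gt_atTop 0]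
      with n hn hpn hn0
    have hn' := ((extractsWithProb_iff hP.1 hQ.1 n ⌊τ * n⌋₊ (p n)).1 hn).2
    have h2 := sum_rpow_le_of_truncSum_le (powDist_nonneg hP.1 n)
      (fun y => mul_nonneg hpn.le (powDist_nonneg hQ.1 _ y)) hn' h0 h1
    simp_rw [Real.mul_rpow hpn.le (powDist_nonneg hQ.1 _ _)] at h2
    rw [← Finset.mul_sum, sum_rpow_powDist hP.1 h0, sum_rpow_powDist hQ.1 h0] at h2
    have h3 := Real.log_le_log (mul_pos (Real.rpow_pos_of_pos hpn α) (pow_pos (powSum_pos hQ α) _))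
      h2
    rw [Real.log_mul (Real.rpow_pos_of_pos hpn α).ne' (pow_pos (powSum_pos hQ α) _).ne',
      Real.log_rpow hpn, Real.log_pow, Real.log_pow] at h3
    have hn1 : (0 : ℝ) < n := by exact_mod_cast hn0
    rw [div_mul_eq_mul_div, ← add_div, div_le_iff₀ hn1]
    linarith
  have hlim : Tendsto (fun n : ℕ => α * Real.log (p n) / n +
      (⌊τ * n⌋₊ : ℝ) / n * Real.log (powSum α Q)) atTop (𝓝 (0 + τ * Real.log (powSum α Q))) := by
    refine Tendsto.add ?_ (Tendsto.mul_const _ ?_)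
    · have h2 : Tendsto (fun n => α * Real.log (p n)) atTop (𝓝 (α * Real.log 1)) :=
        (((Real.continuousAt_log one_ne_zero).tendsto.comp hp)).const_mul α
      exact h2.div_atTop tendsto_natCast_atTop_atTop
    · exact (tendsto_nat_floor_mul_div_atTop hτ).comp tendsto_natCast_atTop_atTop
  have h4 := le_of_tendsto hlim hev2
  rw [zero_add, log_powSum α h1.ne, log_powSum α h1.ne] at h4
  have h5 : 0 < (1 - α) * Real.log 2 := mul_pos (by linarith) (Real.log_pos one_lt_two)
  refine le_of_mul_le_mul_right ?_ h5
  linarith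

/-! ### Concentration and exponents of threshold sums -/

/-- A Chernoff bound for sums of independent bounded centred variables on a finite alphabet,
uniform in the law and in the variable. -/
theorem exists_chernoff_bound {L ε : ℝ} (hL : 0 < L) (hε : 0 < ε) :
    ∃ c > 0, ∀ {ι : Type} (S : Finset ι) (T v : ι → ℝ), (∀ i ∈ S, 0 ≤ T i) →
      ∑ i ∈ S, T i = 1 → ∑ i ∈ S, T i * v i = 0 → (∀ i ∈ S, |v i| ≤ L) → ∀ n : ℕ,
      ∑ x ∈ Fintype.piFinset fun _ : Fin n => S, (if n * ε < ∑ k, v (x k) then powDist T n x else 0)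
        ≤ Real.exp (-c * n) := by
  -- The first bound gives `|l * v| ≤ 1`, where `exp y ≤ 1 + y + y ^ 2`; the second makes the
  -- quadratic term at most half of the gain `l * ε`.
  set l := min (1 / L) (ε / (2 * L ^ 2)) with hl
  have hl0 : 0 < l := by positivity
  have hl1 : l * L ≤ 1 := by
    have := mul_le_mul_of_nonneg_right (min_le_left (1 / L) (ε / (2 * L ^ 2))) hL.le
    rwa [div_mul_cancel₀ _ hL.ne'] at this
  have hl2 : l * L ^ 2 ≤ ε / 2 := by
    have := mul_le_mul_of_nonneg_right (min_le_right (1 / L) (ε / (2 * L ^ 2))) (sq_nonneg L)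
    refine this.trans (le_of_eq ?_)
    field_simp
  refine ⟨l * ε / 2, by positivity, ?_⟩
  intro ι S T v hT hT1 hTv hv n
  have h1 : ∑ i ∈ S, T i * Real.exp (l * (v i - ε)) ≤ Real.exp (-(l * ε / 2)) := by
    have h2 : ∀ i ∈ S, T i * Real.exp (l * v i) ≤ T i * (1 + l ^ 2 * L ^ 2) + l * (T i * v i) := by
      intro i hi
      have h3 : |l * v i| ≤ 1 := by
        rw [abs_mul, abs_of_pos hl0]
        exact (mul_le_mul_of_nonneg_left (hv i hi) hl0.le).trans hl1
      have h4 := (abs_le.1 (Real.abs_exp_sub_one_sub_id_le h3)).2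
      have h5 : v i ^ 2 ≤ L ^ 2 := sq_le_sq' (abs_le.1 (hv i hi)).1 (abs_le.1 (hv i hi)).2
      have h6 := mul_le_mul_of_nonneg_left h5 (sq_nonneg l)
      have h7 : Real.exp (l * v i) ≤ 1 + l ^ 2 * L ^ 2 + l * v i := by
        rw [mul_pow] at h4; linarith
      have := mul_le_mul_of_nonneg_left h7 (hT i hi)
      linarith
    have h3 := Finset.sum_le_sum h2
    rw [Finset.sum_add_distrib, ← Finset.sum_mul, ← Finset.mul_sum, hT1, hTv] at h3
    have h4 : ∑ i ∈ S, T i * Real.exp (l * (v i - ε)) =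
        (∑ i ∈ S, T i * Real.exp (l * v i)) * Real.exp (-(l * ε)) := by
      rw [Finset.sum_mul]
      refine Finset.sum_congr rfl fun i _ => ?_
      rw [mul_assoc, ← Real.exp_add]; congr 2; ring
    rw [h4]
    have h5 : ∑ i ∈ S, T i * Real.exp (l * v i) ≤ Real.exp (l ^ 2 * L ^ 2) := by
      have := Real.add_one_le_exp (l ^ 2 * L ^ 2)
      linarith
    refine (mul_le_mul_of_nonneg_right h5 (Real.exp_pos _).le).trans ?_
    rw [← Real.exp_add, Real.exp_le_exp]
    have := mul_le_mul_of_nonneg_left hl2 hl0.le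
    linarith
  have h8 : ∀ x ∈ Fintype.piFinset fun _ : Fin n => S,
      (if n * ε < ∑ k, v (x k) then powDist T n x else 0) ≤
        powDist (fun i => T i * Real.exp (l * (v i - ε))) n x := by
    intro x hx
    have hTx : 0 ≤ powDist T n x :=
      Finset.prod_nonneg fun k _ => hT _ (Fintype.mem_piFinset.1 hx k)
    have h9 : powDist (fun i => T i * Real.exp (l * (v i - ε))) n x =
        powDist T n x * Real.exp (l * (∑ k, v (x k) - n * ε)) := by
      simp only [powDist, Finset.prod_mul_distrib]
      rw [← Real.exp_sum, ← Finset.mul_sum, Finset.sum_sub_distrib]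
      simp
    rw [h9]
    split_ifs with hc
    · refine le_mul_of_one_le_right hTx (Real.one_le_exp ?_)
      exact mul_nonneg hl0.le (by linarith)
    · exact mul_nonneg hTx (Real.exp_pos _).le
  refine (Finset.sum_le_sum h8).trans ?_
  rw [sum_piFinset_powDist]
  refine (pow_le_pow_left₀ (Finset.sum_nonneg fun i hi =>
    mul_nonneg (hT i hi) (Real.exp_pos _).le) h1 n).trans (le_of_eq ?_)
  rw [← Real.exp_nat_mul]
  congr 1; ring

theorem truncSum_mono {ι : Type} [Fintype ι] (p : ι → ℝ) : Monotone (truncSum p) :=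
  fun _ _ h => Finset.sum_le_sum fun _ _ => min_le_min_left _ h

theorem truncSum_le_sum {ι : Type} [Fintype ι] (p : ι → ℝ) (t : ℝ) : truncSum p t ≤ ∑ i, p i :=
  Finset.sum_le_sum fun _ _ => min_le_left _ _

/-- Concavity of the threshold sum, which vanishes at zero. -/
theorem div_mul_truncSum_le {ι : Type} [Fintype ι] {p : ι → ℝ} (hp : ∀ i, 0 ≤ p i) {t s : ℝ}
    (ht : 0 ≤ t) (hs : 0 < s) (hts : t ≤ s) : t / s * truncSum p s ≤ truncSum p t := by
  rw [truncSum, Finset.mul_sum]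
  refine Finset.sum_le_sum fun i _ => le_min ?_ ?_
  · have h1 : t / s ≤ 1 := div_le_one_of_le₀ hts hs.le
    have h2 : t / s * min (p i) s ≤ t / s * p i :=
      mul_le_mul_of_nonneg_left (min_le_left _ _) (by positivity)
    exact h2.trans (mul_le_of_le_one_left (hp i) h1)
  · have h2 : t / s * min (p i) s ≤ t / s * s :=
      mul_le_mul_of_nonneg_left (min_le_right _ _) (by positivity)
    rwa [div_mul_cancel₀ _ hs.ne'] at h2

theorem truncSum_const_mul_le {ι : Type} [Fintype ι] {q : ι → ℝ} (hq : ∀ i, 0 ≤ q i) {c : ℝ}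
    (hc : c ≤ 1) (t : ℝ) : truncSum (fun i => c * q i) t ≤ truncSum q t :=
  Finset.sum_le_sum fun i _ => min_le_min_right _ (mul_le_of_le_one_left (hq i) hc)

section

variable {d : ℕ} {P : Fin d → ℝ}

theorem truncSum_powDist_eq (n : ℕ) {t : ℝ} (ht : 0 ≤ t) :
    truncSum (powDist P n) t = ∑ x ∈ Fintype.piFinset
      fun _ : Fin n => Finset.univ.filter fun i => P i ≠ 0, min (powDist P n x) t := by
  refine (Finset.sum_subset (Finset.subset_univ _) fun x _ hx => ?_).symm
  simp only [Fintype.mem_piFinset, Finset.mem_filter, Finset.mem_univ, true_and, not_forall,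
    not_not] at hx
  obtain ⟨k, hk⟩ := hx
  rw [powDist, Finset.prod_eq_zero (Finset.mem_univ k) hk, min_eq_left ht]

/-- Termwise `min x t ≤ x ^ α * t ^ (1 - α)`. The sum runs over the support, so `α = 0` is allowed.
-/
theorem truncSum_powDist_le (hP : P ∈ stdSimplex ℝ (Fin d)) (n : ℕ) {t α : ℝ} (ht : 0 < t)
    (h0 : 0 ≤ α) (h1 : α ≤ 1) : truncSum (powDist P n) t ≤ t ^ (1 - α) * powSum α P ^ n := by
  rw [truncSum_powDist_eq n ht.le, powSum, ← sum_piFinset_powDist, Finset.mul_sum]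
  refine Finset.sum_le_sum fun x hx => ?_
  have hx0 : 0 < powDist P n x :=
    Finset.prod_pos fun k _ => pos_of_mem_support hP (Fintype.mem_piFinset.1 hx k)
  have h2 : powDist (fun i => P i ^ α) n x = powDist P n x ^ α :=
    Real.finsetProd_rpow _ _ (fun i _ => hP.1 (x i)) α
  rw [h2]
  have hm : 0 < min (powDist P n x) t := lt_min hx0 ht
  calc min (powDist P n x) t = min (powDist P n x) t ^ (1 - α) * min (powDist P n x) t ^ α := by
        rw [← Real.rpow_add hm]; simp
    _ ≤ t ^ (1 - α) * powDist P n x ^ α := by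
        refine mul_le_mul (Real.rpow_le_rpow hm.le (min_le_right _ _) (by linarith))
          (Real.rpow_le_rpow hm.le (min_le_left _ _) h0) (Real.rpow_nonneg hm.le _)
          (Real.rpow_nonneg ht.le _)

/-- The mean of `-log P` under the law proportional to `P ^ α`. -/
noncomputable def tiltedMean (α : ℝ) (P : Fin d → ℝ) : ℝ :=
  ∑ i with P i ≠ 0, P i ^ α / powSum α P * -Real.log (P i)

theorem continuous_powSum (hP : P ∈ stdSimplex ℝ (Fin d)) : Continuous fun α => powSum α P :=
  continuous_iff_continuousAt.2 fun α => (hasDerivAt_powSum hP α).continuousAt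

theorem continuous_log_powSum (hP : P ∈ stdSimplex ℝ (Fin d)) :
    Continuous fun α => Real.log (powSum α P) :=
  (continuous_powSum hP).log fun α => (powSum_pos hP α).ne'

theorem continuous_tiltedMean (hP : P ∈ stdSimplex ℝ (Fin d)) :
    Continuous fun α => tiltedMean α P := by
  unfold tiltedMean
  refine continuous_finsetSum _ fun i hi => Continuous.mul (Continuous.div ?_
    (continuous_powSum hP) fun α => (powSum_pos hP α).ne') continuous_const
  exact Real.continuous_const_rpow (pos_of_mem_support hP hi).ne'

theorem tiltedMean_one (hP : P ∈ stdSimplex ℝ (Fin d)) :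
    tiltedMean 1 P = renyiEntropy 1 P * Real.log 2 := by
  rw [renyiEntropy_one_mul_log, tiltedMean, powSum_one hP]
  simp

theorem sum_tilted (hP : P ∈ stdSimplex ℝ (Fin d)) (α : ℝ) :
    ∑ i with P i ≠ 0, P i ^ α / powSum α P = 1 := by
  rw [← Finset.sum_div]
  exact div_self (powSum_pos hP α).ne'

theorem powDist_eq_exp (hP : P ∈ stdSimplex ℝ (Fin d)) {n : ℕ} {x : Fin n → Fin d}
    (hx : x ∈ Fintype.piFinset fun _ : Fin n => Finset.univ.filter fun i => P i ≠ 0) :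
    powDist P n x = Real.exp (-∑ k, -Real.log (P (x k))) := by
  rw [Finset.sum_neg_distrib, neg_neg, Real.exp_sum]
  exact Finset.prod_congr rfl fun k _ =>
    (Real.exp_log (pos_of_mem_support hP (Fintype.mem_piFinset.1 hx k))).symm

theorem powDist_tilted_eq_exp (hP : P ∈ stdSimplex ℝ (Fin d)) (α : ℝ) {n : ℕ} {x : Fin n → Fin d}
    (hx : x ∈ Fintype.piFinset fun _ : Fin n => Finset.univ.filter fun i => P i ≠ 0) :
    powDist (fun i => P i ^ α / powSum α P) n x =
      Real.exp (-(α * ∑ k, -Real.log (P (x k))) - n * Real.log (powSum α P)) := by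
  have h1 : ∀ k, P (x k) ^ α / powSum α P =
      Real.exp (-(α * -Real.log (P (x k))) - Real.log (powSum α P)) := by
    intro k
    rw [Real.exp_sub, Real.exp_log (powSum_pos hP α),
      Real.rpow_def_of_pos (pos_of_mem_support hP (Fintype.mem_piFinset.1 hx k))]
    congr 2; ring
  rw [powDist, Finset.prod_congr rfl fun k _ => h1 k, ← Real.exp_sum, Finset.sum_sub_distrib,
    Finset.sum_neg_distrib, Finset.mul_sum]
  simp

/-- The bound must not depend on `α`, which later varies with the threshold and with `n`. -/
theorem exists_log_bound (hP : P ∈ stdSimplex ℝ (Fin d)) :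
    ∃ L > 0, ∀ α, ∀ i ∈ Finset.univ.filter (fun i => P i ≠ 0),
      |-Real.log (P i) - tiltedMean α P| ≤ L := by
  set M := ∑ i, |Real.log (P i)|
  have hM : ∀ i, -Real.log (P i) ≤ M := fun i => (neg_le_abs _).trans
    (Finset.single_le_sum (f := fun i => |Real.log (P i)|) (fun j _ => abs_nonneg _)
      (Finset.mem_univ i))
  have h0 : ∀ i, 0 ≤ -Real.log (P i) := fun i =>
    neg_nonneg.2 (Real.log_nonpos (hP.1 i) (le_one_of_mem_stdSimplex hP i))
  refine ⟨M + 1, ?_, fun α i _ => ?_⟩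
  · have : 0 ≤ M := Finset.sum_nonneg fun i _ => abs_nonneg _
    linarith
  have hw : ∀ i, 0 ≤ P i ^ α / powSum α P := fun i =>
    div_nonneg (Real.rpow_nonneg (hP.1 i) _) (powSum_pos hP α).le
  have h1 : 0 ≤ tiltedMean α P := Finset.sum_nonneg fun i _ => mul_nonneg (hw i) (h0 i)
  have h2 : tiltedMean α P ≤ M := by
    have : tiltedMean α P ≤ ∑ i with P i ≠ 0, P i ^ α / powSum α P * M :=
      Finset.sum_le_sum fun i _ => mul_le_mul_of_nonneg_left (hM i) (hw i)
    rwa [← Finset.sum_mul, sum_tilted hP, one_mul] at this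
  rw [abs_le]
  constructor <;> linarith [hM i, h0 i]

/-- Concentration of `-log P` around its mean under the tilted law. -/
theorem exists_tilted_concentration (hP : P ∈ stdSimplex ℝ (Fin d)) {ε : ℝ} (hε : 0 < ε) :
    ∃ c > 0, ∀ α, ∀ n : ℕ,
      1 - 2 * Real.exp (-c * n) ≤
        ∑ x ∈ Fintype.piFinset fun _ : Fin n => Finset.univ.filter fun i => P i ≠ 0,
        (if |∑ k, -Real.log (P (x k)) - n * tiltedMean α P| ≤ n * ε then
          powDist (fun i => P i ^ α / powSum α P) n x else 0) := by
  obtain ⟨L, hL, hbd⟩ := exists_log_bound hP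
  obtain ⟨c, hc, hch⟩ := exists_chernoff_bound hL hε
  refine ⟨c, hc, fun α n => ?_⟩
  set S := Finset.univ.filter fun i => P i ≠ 0
  set T := fun i => P i ^ α / powSum α P
  set v := fun i => -Real.log (P i) - tiltedMean α P
  have hT : ∀ i, 0 ≤ T i := fun i =>
    div_nonneg (Real.rpow_nonneg (hP.1 i) _) (powSum_pos hP α).le
  have hTv : ∑ i ∈ S, T i * v i = 0 := by
    simp only [v, mul_sub, Finset.sum_sub_distrib, ← Finset.sum_mul]
    rw [sum_tilted hP α, one_mul, sub_eq_zero]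
    rfl
  have h1 := hch S T v (fun i _ => hT i) (sum_tilted hP α) hTv (hbd α) n
  have h2 := hch S T (fun i => -v i) (fun i _ => hT i) (sum_tilted hP α)
    (by simp only [mul_neg, Finset.sum_neg_distrib, hTv, neg_zero])
    (fun i hi => by rw [abs_neg]; exact hbd α i hi) n
  have h3 : ∑ x ∈ Fintype.piFinset fun _ : Fin n => S, powDist T n x = 1 := by
    rw [sum_piFinset_powDist, sum_tilted hP α, one_pow]
  have h4 : ∀ x : Fin n → Fin d, ∑ k, -Real.log (P (x k)) - n * tiltedMean α P = ∑ k, v (x k) := by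
    intro x; simp [v, Finset.sum_sub_distrib]
  have h5 : ∑ x ∈ Fintype.piFinset fun _ : Fin n => S, powDist T n x ≤
      ∑ x ∈ Fintype.piFinset fun _ : Fin n => S,
      ((if |∑ k, -Real.log (P (x k)) - n * tiltedMean α P| ≤ n * ε then powDist T n x else 0) +
      (if n * ε < ∑ k, v (x k) then powDist T n x else 0) +
      (if n * ε < ∑ k, -v (x k) then powDist T n x else 0)) := by
    refine Finset.sum_le_sum fun x _ => ?_
    have hx := powDist_nonneg hT n x
    rw [h4, Finset.sum_neg_distrib]
    by_cases ha : |∑ k, v (x k)| ≤ n * ε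
    · rw [if_pos ha]
      split_ifs <;> linarith
    · rcases lt_abs.1 (not_le.1 ha) with hb | hb
      · rw [if_pos hb]
        split_ifs <;> linarith
      · rw [if_pos hb]
        split_ifs <;> linarith
  rw [Finset.sum_add_distrib, Finset.sum_add_distrib, h3] at h5
  linarith

/-- Words typical for the tilted law have `P`-probability near `exp (-n * s α)`. There, up to `exp
(2 * n * ε)`, both the probability and the threshold dominate the tilted probability times the
claimed exponential. -/
theorem exists_truncSum_powDist_ge (hP : P ∈ stdSimplex ℝ (Fin d)) {ε : ℝ} (hε : 0 < ε) :
    ∃ c > 0, ∀ α, 0 ≤ α → α ≤ 1 → ∀ n : ℕ,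
      (1 - 2 * Real.exp (-c * n)) * Real.exp (n * (Real.log (powSum α P) -
        (1 - α) * tiltedMean α P) - 2 * (n * ε)) ≤
      truncSum (powDist P n) (Real.exp (-(n * tiltedMean α P))) := by
  obtain ⟨c, hc, h⟩ := exists_tilted_concentration hP hε
  refine ⟨c, hc, fun α h0 h1 n => ?_⟩
  rw [truncSum_powDist_eq n (Real.exp_pos _).le]
  refine (mul_le_mul_of_nonneg_right (h α n) (Real.exp_pos _).le).trans ?_
  rw [Finset.sum_mul]
  refine Finset.sum_le_sum fun x hx => ?_
  split_ifs with hty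
  · rw [powDist_eq_exp hP hx, powDist_tilted_eq_exp hP α hx, ← Real.exp_add]
    set W := ∑ k, -Real.log (P (x k))
    obtain ⟨hl, hu⟩ := abs_le.1 hty
    have hn : 0 ≤ n * ε := by positivity
    have h2 := mul_le_mul_of_nonneg_left hl h0
    have h3 : α * (n * ε) ≤ n * ε := mul_le_of_le_one_left hn h1
    refine le_min (Real.exp_le_exp.2 ?_) (Real.exp_le_exp.2 ?_) <;> linarith
  · rw [zero_mul]
    exact le_min (powDist_nonneg hP.1 n x) (Real.exp_pos _).le

/-- At `α = 1` the tilted law is `P` itself, and its typical words lie below the threshold, so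
truncation leaves them intact. -/
theorem exists_truncSum_powDist_ge_one_sub (hP : P ∈ stdSimplex ℝ (Fin d)) {δ : ℝ} (hδ : 0 < δ) :
    ∃ c > 0, ∀ n : ℕ, 1 - 2 * Real.exp (-c * n) ≤
      truncSum (powDist P n) (Real.exp (-(n * (tiltedMean 1 P - δ)))) := by
  obtain ⟨c, hc, h⟩ := exists_tilted_concentration hP hδ
  refine ⟨c, hc, fun n => (h 1 n).trans ?_⟩
  rw [truncSum_powDist_eq n (Real.exp_pos _).le]
  refine Finset.sum_le_sum fun x hx => ?_
  simp only [powSum_one hP, div_one, Real.rpow_one]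
  split_ifs with hty
  · refine le_min le_rfl ?_
    rw [powDist_eq_exp hP hx, Real.exp_le_exp]
    linarith [(abs_le.1 hty).1]
  · exact le_min (powDist_nonneg hP.1 n x) (Real.exp_pos _).le

end

/-! ### Achievability -/

section

variable {d₁ d₂ : ℕ} {P : Fin d₁ → ℝ} {Q : Fin d₂ → ℝ}

theorem log_powSum_of_mem (hP : P ∈ stdSimplex ℝ (Fin d₁)) (α : ℝ) :
    Real.log (powSum α P) = (1 - α) * (renyiEntropy α P * Real.log 2) := by
  by_cases h : α = 1
  · subst h; simp [powSum_one hP]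
  · exact log_powSum α h

theorem powSum_pow_floor_le (hQ : Q ∈ stdSimplex ℝ (Fin d₂)) {α τ : ℝ} (hα : α ≤ 1) (hτ : 0 ≤ τ)
    (n : ℕ) : powSum α Q ^ ⌊τ * n⌋₊ ≤ Real.exp (n * (τ * Real.log (powSum α Q))) := by
  have h1 : Real.log (powSum α Q ^ ⌊τ * n⌋₊) ≤ n * (τ * Real.log (powSum α Q)) := by
    rw [Real.log_pow, ← mul_assoc, mul_comm (n : ℝ) τ]
    exact mul_le_mul_of_nonneg_right (Nat.floor_le (by positivity))
      (Real.log_nonneg (one_le_powSum hQ hα))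
  rw [← Real.exp_log (pow_pos (powSum_pos hQ α) ⌊τ * n⌋₊)]
  exact Real.exp_le_exp.2 h1

theorem truncSum_powDist_floor_le (hQ : Q ∈ stdSimplex ℝ (Fin d₂)) {α τ : ℝ} (h0 : 0 ≤ α)
    (hα : α ≤ 1) (hτ : 0 ≤ τ) (n : ℕ) (r : ℝ) :
    truncSum (powDist Q ⌊τ * n⌋₊) (Real.exp (-(n * r))) ≤
      Real.exp (n * (τ * Real.log (powSum α Q) - (1 - α) * r)) := by
  refine (truncSum_powDist_le hQ _ (Real.exp_pos _) h0 hα).trans ?_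
  refine (mul_le_mul_of_nonneg_left (powSum_pow_floor_le hQ hα hτ n)
    (Real.rpow_nonneg (Real.exp_pos _).le _)).trans (le_of_eq ?_)
  rw [← Real.exp_mul, ← Real.exp_add]
  congr 1; ring

/-- A rate whose product with every Rényi entropy of `Q` is strictly below that of `P` is
achievable. -/
theorem isAchievableRate_of_forall_mul_lt (hP : P ∈ stdSimplex ℝ (Fin d₁))
    (hQ : Q ∈ stdSimplex ℝ (Fin d₂)) {τ : ℝ} (hτ : 0 ≤ τ)
    (h : ∀ α, 0 ≤ α → α ≤ 1 → τ * renyiEntropy α Q < renyiEntropy α P) :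
    IsAchievableRate (schmidtState P) (schmidtState Q) τ := by
  have hlog2 := Real.log_pos one_lt_two
  set s := fun α => tiltedMean α P with hs
  -- the regime where the threshold sums of `Q` are already exponentially small
  obtain ⟨β, δ, hβ0, hβ1, hδ, hβ⟩ : ∃ β δ : ℝ, 0 ≤ β ∧ β < 1 ∧ 0 < δ ∧
      τ * (renyiEntropy β Q * Real.log 2) < s 1 - 2 * δ := by
    have h1 : τ * (renyiEntropy 1 Q * Real.log 2) < s 1 := by
      rw [hs]
      simp only [tiltedMean_one hP]
      rw [← mul_assoc]
      exact mul_lt_mul_of_pos_right (h 1 zero_le_one le_rfl) hlog2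
    set δ := (s 1 - τ * (renyiEntropy 1 Q * Real.log 2)) / 4 with hδ
    have hcont : Continuous fun β => τ * (renyiEntropy β Q * Real.log 2) :=
      continuous_const.mul ((continuous_renyiEntropy hQ).mul continuous_const)
    have hev : ∀ᶠ β in 𝓝[<] (1 : ℝ), τ * (renyiEntropy β Q * Real.log 2) < s 1 - 2 * δ :=
      nhdsWithin_le_nhds (hcont.continuousAt.eventually (gt_mem_nhds (by linarith)))
    have hmem : ∀ᶠ β in 𝓝[<] (1 : ℝ), β ∈ Set.Ioo (0 : ℝ) 1 := Ioo_mem_nhdsLT zero_lt_one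
    obtain ⟨β, hβ, hβ'⟩ := (hev.and hmem).exists
    exact ⟨β, δ, hβ'.1.le, hβ'.2, by linarith, hβ⟩
  -- This is the decay exponent of the threshold sum of `Q` at `exp (-n * (s 1 - δ))`, from the
  -- bound of order `β`.
  set η := (1 - β) * δ with hη
  have hη0 : 0 < η := mul_pos (by linarith) hδ
  -- The exponent of `P` vanishes at `α = 1`, so by continuity it exceeds `-η / 4` at some `α₀ < 1`.
  obtain ⟨α₀, hα₀0, hα₀1, hα₀⟩ : ∃ α₀ : ℝ, 0 ≤ α₀ ∧ α₀ < 1 ∧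
      -(η / 4) < Real.log (powSum α₀ P) - (1 - α₀) * s α₀ := by
    have hcont : Continuous fun α => Real.log (powSum α P) - (1 - α) * s α :=
      (continuous_log_powSum hP).sub
        ((continuous_const.sub continuous_id).mul (continuous_tiltedMean hP))
    have hev : ∀ᶠ α in 𝓝[<] (1 : ℝ), -(η / 4) < Real.log (powSum α P) - (1 - α) * s α :=
      nhdsWithin_le_nhds (hcont.continuousAt.eventually (lt_mem_nhds (by
        simp only [powSum_one hP, Real.log_one, sub_self, zero_mul]; linarith)))
    have hmem : ∀ᶠ β in 𝓝[<] (1 : ℝ), β ∈ Set.Ioo (0 : ℝ) 1 := Ioo_mem_nhdsLT zero_lt_one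
    obtain ⟨β, hβ, hβ'⟩ := (hev.and hmem).exists
    exact ⟨β, hβ'.1.le, hβ'.2, hβ⟩
  -- Away from `α = 1` the gap is uniformly positive by compactness.
  obtain ⟨γ, hγ, hgap⟩ : ∃ γ > 0, ∀ α ∈ Set.Icc 0 α₀,
      γ ≤ Real.log (powSum α P) - τ * Real.log (powSum α Q) := by
    obtain ⟨α₁, hα₁, hmin⟩ := isCompact_Icc.exists_isMinOn (Set.nonempty_Icc.2 hα₀0)
      ((continuous_log_powSum hP).sub
        (continuous_const.mul (continuous_log_powSum hQ) (f := fun _ => τ))).continuousOn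
    refine ⟨_, ?_, fun α hα => hmin hα⟩
    change 0 < Real.log (powSum α₁ P) - τ * Real.log (powSum α₁ Q)
    rw [log_powSum_of_mem hP, log_powSum_of_mem hQ]
    have h1 := h α₁ hα₁.1 (hα₁.2.trans hα₀1.le)
    have h2 : 0 < (1 - α₁) * ((renyiEntropy α₁ P - τ * renyiEntropy α₁ Q) * Real.log 2) :=
      mul_pos (by linarith [hα₁.2]) (mul_pos (by linarith) hlog2)
    linarith
  -- The concentration loss `2 * ε`, plus the exponent spent on the prefactor, must fit below `η`
  -- and below `γ`.
  set ε := min (η / 8) (γ / 4) with hε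
  have hε0 : 0 < ε := by positivity
  have hεη : ε ≤ η / 8 := min_le_left _ _
  have hεγ : ε ≤ γ / 4 := min_le_right _ _
  obtain ⟨c, hc, hge⟩ := exists_truncSum_powDist_ge hP hε0
  obtain ⟨c', hc', hge'⟩ := exists_truncSum_powDist_ge_one_sub hP hδ
  have hexp : ∀ {r : ℝ}, 0 < r → Tendsto (fun n : ℕ => Real.exp (-r * n)) atTop (𝓝 0) := by
    intro r hr
    have : Tendsto (fun n : ℕ => r * (n : ℝ)) atTop atTop :=
      tendsto_natCast_atTop_atTop.const_mul_atTop hr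
    simpa [Function.comp_def] using Real.tendsto_exp_neg_atTop_nhds_zero.comp this
  refine ⟨hτ, fun n => 1 - 2 * Real.exp (-c' * n), ?_, ?_⟩
  · simpa using ((hexp hc').const_mul 2).const_sub 1
  filter_upwards [(hexp hc').eventually (gt_mem_nhds (show (0 : ℝ) < 1 / 4 by norm_num)),
    (hexp hc).eventually (gt_mem_nhds (show (0 : ℝ) < 1 / 4 by norm_num)),
    (hexp (show 0 < η / 4 by positivity)).eventually
      (gt_mem_nhds (show (0 : ℝ) < 1 / 2 by norm_num)),
    (hexp (show 0 < γ / 4 by positivity)).eventually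
      (gt_mem_nhds (show (0 : ℝ) < 1 / 2 by norm_num)),
    eventually_gt_atTop 0] with n hn1 hn2 hn3 hn4 hn0
  have hn : (0 : ℝ) < n := by exact_mod_cast hn0
  rw [extractsWithProb_iff hP.1 hQ.1]
  refine ⟨by linarith, fun t ht => ?_⟩
  set m := ⌊τ * n⌋₊
  set p := 1 - 2 * Real.exp (-c' * n)
  have hp1 : p ≤ 1 := by
    have := Real.exp_pos (-c' * n)
    simp only [p]; linarith
  have hqn : ∀ y, 0 ≤ powDist Q m y := powDist_nonneg hQ.1 m
  -- For large `n` the factor `1 - 2 * exp (-c * n)` is at least `1 / 2`, hence absorbed into `exp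
  -- (-r * n)`.
  have hlow : ∀ α, 0 ≤ α → α ≤ 1 → ∀ r, 1 / 2 ≥ Real.exp (-r * n) →
      Real.exp (n * (Real.log (powSum α P) - (1 - α) * s α) - 2 * (n * ε) - r * n) ≤
        truncSum (powDist P n) (Real.exp (-(n * s α))) := by
    intro α h0 h1 r hr
    refine le_trans ?_ (hge α h0 h1 n)
    rw [sub_eq_add_neg _ (r * n), Real.exp_add, mul_comm, ← neg_mul]
    exact mul_le_mul_of_nonneg_right (by linarith) (Real.exp_pos _).le
  -- Large thresholds: the truncated mass of `P^n` already reaches the success probability, which is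
  -- the total mass on the other side.
  by_cases ht1 : Real.exp (-(n * (s 1 - δ))) ≤ t
  · refine le_trans ?_ ((hge' n).trans (truncSum_mono _ ht1))
    refine (truncSum_le_sum _ _).trans (le_of_eq ?_)
    rw [← Finset.mul_sum, sum_powDist, hQ.2, one_pow, mul_one]
  push Not at ht1
  refine (truncSum_const_mul_le hqn hp1 t).trans ?_
  -- Near `α = 1`: by monotonicity, compare `Q` at the upper end of the range with `P` at the lower
  -- end; `-η` lies below `-3 * η / 4`.
  by_cases ht2 : Real.exp (-(n * s α₀)) ≤ t
  · refine ((truncSum_mono _ ht1.le).trans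
      (truncSum_powDist_floor_le hQ hβ0 hβ1.le hτ n (s 1 - δ))).trans
      (le_trans ?_ ((hlow α₀ hα₀0 hα₀1.le (η / 4) hn3.le).trans (truncSum_mono _ ht2)))
    rw [Real.exp_le_exp, log_powSum_of_mem hQ β]
    have e1 : τ * ((1 - β) * (renyiEntropy β Q * Real.log 2)) - (1 - β) * (s 1 - δ) ≤ -η := by
      have := mul_le_mul_of_nonneg_left hβ.le (show 0 ≤ 1 - β by linarith)
      rw [hη]; linarith
    have e2 := mul_le_mul_of_nonneg_left e1 hn.le
    have e3 := mul_le_mul_of_nonneg_left hα₀.le hn.le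
    have e4 := mul_le_mul_of_nonneg_left hεη hn.le
    have e5 := mul_pos hn hη0
    linarith
  push Not at ht2
  rcases ht.eq_or_lt with rfl | ht0
  · refine le_of_eq ?_
    simp [truncSum, min_eq_right (hqn _), min_eq_right (powDist_nonneg hP.1 n _)]
  -- Middle range: the intermediate value theorem matches `t` to an order `α`, and both exponents
  -- are compared at that same order.
  by_cases ht3 : Real.exp (-(n * s 0)) ≤ t
  · have hlt : t = Real.exp (-(n * (-Real.log t / n))) := by
      rw [mul_div_cancel₀ _ hn.ne', neg_neg, Real.exp_log ht0]
    have hmem : -Real.log t / n ∈ Set.Icc (s α₀) (s 0) := by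
      have h2 := Real.log_lt_log ht0 ht2
      have h3 := Real.log_le_log (Real.exp_pos _) ht3
      rw [Real.log_exp] at h2 h3
      exact ⟨(le_div_iff₀ hn).2 (by linarith), (div_le_iff₀ hn).2 (by linarith)⟩
    obtain ⟨α, hα, hsα⟩ :=
      intermediate_value_Icc' hα₀0 (continuous_tiltedMean hP).continuousOn hmem
    rw [hlt, ← hsα]
    have hα1 := hα.2.trans hα₀1.le
    refine (truncSum_powDist_floor_le hQ hα.1 hα1 hτ n _).trans
      (le_trans ?_ (hlow α hα.1 hα1 (γ / 4) hn4.le))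
    rw [Real.exp_le_exp]
    have e1 := mul_le_mul_of_nonneg_left (hgap α hα) hn.le
    have e2 := mul_le_mul_of_nonneg_left hεγ hn.le
    have e3 := mul_pos hn hγ
    change _ ≤ n * (Real.log (powSum α P) - (1 - α) * tiltedMean α P) - _ - _
    linarith
  -- Smallest thresholds: `P` is bounded below linearly by concavity and `Q` above by `t` times its
  -- support size, so order `0` decides.
  · push Not at ht3
    refine le_trans ?_ (div_mul_truncSum_le (powDist_nonneg hP.1 n) ht (Real.exp_pos _) ht3.le)
    have h1 := truncSum_powDist_le hQ m ht0 le_rfl zero_le_one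
    rw [sub_zero, Real.rpow_one] at h1
    refine (h1.trans (mul_le_mul_of_nonneg_left
      (powSum_pow_floor_le hQ zero_le_one hτ n) ht)).trans ?_
    rw [div_mul_eq_mul_div, mul_div_assoc]
    refine mul_le_mul_of_nonneg_left ?_ ht
    rw [le_div_iff₀ (Real.exp_pos _), ← Real.exp_add]
    refine le_trans ?_ (hlow 0 le_rfl zero_le_one (γ / 4) hn4.le)
    rw [Real.exp_le_exp]
    have e1 := mul_le_mul_of_nonneg_left (hgap 0 ⟨le_rfl, hα₀0⟩) hn.le
    have e2 := mul_le_mul_of_nonneg_left hεγ hn.le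
    have e3 := mul_pos hn hγ
    linarith

/-- Needed when the minimal ratio is zero, where no nonnegative rate satisfies the strict
inequalities. -/
theorem isAchievableRate_zero (hP : P ∈ stdSimplex ℝ (Fin d₁)) (hQ : Q ∈ stdSimplex ℝ (Fin d₂)) :
    IsAchievableRate (schmidtState P) (schmidtState Q) 0 := by
  refine ⟨le_rfl, fun _ => 1, tendsto_const_nhds, Eventually.of_forall fun n => ?_⟩
  rw [zero_mul, Nat.floor_zero, extractsWithProb_iff hP.1 hQ.1]
  refine ⟨zero_le_one, fun t ht => ?_⟩
  have h1 : truncSum (fun y => 1 * powDist Q 0 y) t = min 1 t := by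
    simp [truncSum, powDist]
  have hsum : ∑ x, powDist P n x = 1 := by rw [sum_powDist, hP.2, one_pow]
  rw [h1]
  by_cases hx : ∃ x, t ≤ powDist P n x
  · obtain ⟨x, hx⟩ := hx
    refine (min_le_right _ _).trans ((min_eq_right hx).symm.le.trans ?_)
    exact Finset.single_le_sum (f := fun x => min (powDist P n x) t)
      (fun y _ => le_min (powDist_nonneg hP.1 n y) ht) (Finset.mem_univ x)
  · push Not at hx
    refine (min_le_left _ _).trans (hsum.symm.le.trans ?_)
    exact Finset.sum_le_sum fun x _ => (min_eq_left (hx x).le).symm.le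

end

end BipartiteLOCC

/-! ### The rate formula -/

theorem theorem5 {d₁ d₂ : ℕ} (P : Fin d₁ → ℝ) (Q : Fin d₂ → ℝ)
    (hP : P ∈ stdSimplex ℝ (Fin d₁)) (hQ : Q ∈ stdSimplex ℝ (Fin d₂))
    (hQ_nondeg : ∀ j, Q j ≠ 1) :
    ∃ m : ℝ,
      IsLeast ((fun α : ℝ => BipartiteLOCC.renyiEntropy α P / BipartiteLOCC.renyiEntropy α Q) ''
        Set.Icc (0 : ℝ) 1) m ∧
      BipartiteLOCC.extractionRate (BipartiteLOCC.schmidtState P) (BipartiteLOCC.schmidtState Q) =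
        (m : EReal) := by
  have hQpos : ∀ α ≤ 1, 0 < BipartiteLOCC.renyiEntropy α Q := fun α hα =>
    BipartiteLOCC.renyiEntropy_pos hQ hQ_nondeg hα
  have hPc := BipartiteLOCC.continuous_renyiEntropy hP
  have hQc := BipartiteLOCC.continuous_renyiEntropy hQ
  have hcont : ContinuousOn
      (fun α : ℝ => BipartiteLOCC.renyiEntropy α P / BipartiteLOCC.renyiEntropy α Q)
      (Set.Icc (0 : ℝ) 1) :=
    hPc.continuousOn.div hQc.continuousOn fun α hα => (hQpos α hα.2).ne'
  obtain ⟨α, hα, hmin⟩ := isCompact_Icc.exists_isMinOn (Set.nonempty_Icc.2 zero_le_one) hcont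
  refine ⟨BipartiteLOCC.renyiEntropy α P / BipartiteLOCC.renyiEntropy α Q,
    ⟨⟨α, hα, rfl⟩, ?_⟩, ?_⟩
  · rintro _ ⟨β, hβ, rfl⟩
    exact hmin hβ
  set m := BipartiteLOCC.renyiEntropy α P / BipartiteLOCC.renyiEntropy α Q with hm
  have hm0 : 0 ≤ m := div_nonneg (BipartiteLOCC.renyiEntropy_nonneg hP hα.2) (hQpos α hα.2).le
  refine le_antisymm (sSup_le ?_) ?_
  · rintro _ ⟨τ, hτ, rfl⟩
    rw [EReal.coe_le_coe_iff, hm, le_div_iff₀ (hQpos α hα.2)]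
    -- The converse is known only for orders in the open interval; closedness carries it to a
    -- minimizer at an endpoint.
    have hcl : IsClosed {β | τ * BipartiteLOCC.renyiEntropy β Q ≤ BipartiteLOCC.renyiEntropy β P} :=
      isClosed_le (continuous_const.mul hQc) hPc
    have hsub : Set.Ioo (0 : ℝ) 1 ⊆
        {β | τ * BipartiteLOCC.renyiEntropy β Q ≤ BipartiteLOCC.renyiEntropy β P} :=
      fun β hβ => hτ.mul_renyiEntropy_le hP hQ hβ.1 hβ.2
    have hmem : α ∈ closure (Set.Ioo (0 : ℝ) 1) := by rwa [closure_Ioo zero_ne_one]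
    exact hcl.closure_subset_iff.2 hsub hmem
  · refine le_of_forall_lt fun b hb => ?_
    rcases hm0.eq_or_lt with h0 | h0
    · refine hb.trans_le (le_sSup ⟨0, BipartiteLOCC.isAchievableRate_zero hP hQ, ?_⟩)
      rw [← h0]
    -- Taking the maximum with `0` keeps `τ` positive even when `b` is negative or `⊥`.
    · obtain ⟨τ, hbτ, hτm⟩ := EReal.lt_iff_exists_real_btwn.1 (max_lt hb (EReal.coe_pos.2 h0))
      have hτ0 : 0 < τ := EReal.coe_pos.1 ((le_max_right _ _).trans_lt hbτ)
      refine ((le_max_left _ _).trans_lt hbτ).trans_le (le_sSup ⟨τ, ?_, rfl⟩)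
      refine BipartiteLOCC.isAchievableRate_of_forall_mul_lt hP hQ hτ0.le fun β hβ0 hβ1 => ?_
      exact (lt_div_iff₀ (hQpos β hβ1)).1 ((EReal.coe_lt_coe_iff.1 hτm).trans_le (hmin ⟨hβ0, hβ1⟩))
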